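/- **Proposition (Asymptotic distribution).** *Setting.* Let $\mathcal X\subset\mathbb R^d$ be contained in the closure of its interior, $\mathcal Y\subset\mathbb R$, $\mathcal Z=\mathcal X\times\mathcal Y$ and $s\in\mathbb N=\{0,1,\dots\}$. For a multi-index $\beta\in\mathbb N^d$ put $|\beta|=\beta_1+\dots+\beta_d$, and let $\mathcal A_s=\{\beta:|\beta|\le s\}$. A function belongs to $C^m$ of such a set if it is continuous on the set, is $C^m$ in the interior, and its derivatives of order at most $m$ extend continuously from the interior to the set; at non-interior points $D^\beta f$ denotes the extended partial derivative. Let $\mathcal H$ be a real reproducing kernel Hilbert space of functions on $\mathcal X$ whose kernel satisfies $K\in C^{2s}(\mathcal X\times\mathcal X)$, and for $\beta\in\mathcal A_s$ let $\phi^{(\beta)}(x)=D^\beta_x K(x,\cdot)$. For measurable weights $w_\beta:\mathcal Z\to\mathbb R$ put, for $z=(x,y)$, $$\mathcal R(h;z)=\sum_{\beta\in\mathcal A_s}w_\beta(z)\,D^\beta h(x),\qquad \psi(z)=\sum_{\beta\in\mathcal A_s}w_\beta(z)\,\phi^{(\beta)}(x).$$ Let $P$ be a probability measure on $\mathcal Z$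 with $\mathbb E_P\|\psi\|^4<\infty$, and let $z_1,z_2,\dots$ be random variables with law $P$ such that the random elements $\psi(z_1),\psi(z_2),\dots$ of $\mathcal H$ are independent (for instance, $z_1,z_2,\dots$ i.i.d. with law $P$). For $\lambda>0$ let $$h_\lambda=\operatorname*{argmin}_{h\in\mathcal H}\Big\{-\mathbb E_P[\mathcal R(h;z)]+\tfrac12\mathbb V_P[\mathcal R(h;z)]+\tfrac\lambda2\|h\|^2\Big\},$$ and let $\hat h_\lambda$ be the minimizer of the same functional with $P$ replaced by the empirical distribution $\frac1N\sum_{i=1}^N\delta_{z_i}$. Write $(f\otimes g)u=\langle u,g\rangle f$ and $$\mu=\mathbb E_P[\psi],\quad \Sigma=\mathbb E_P[(\psi-\mu)\otimes(\psi-\mu)],\quad \Sigma_\lambda=\Sigma+\lambda I,$$ $$F=(\psi-\mu)-\big((\psi-\mu)\otimes(\psi-\mu)-\Sigma\big)h_\lambda,\quad Q_\lambda=\mathbb E_P[F\otimes F].$$ *Claim.* All these objects are well defined: $\mathcal H\subset C^s(\mathcal X)$; for $\beta\in\mathcal A_s$ and $x\in\mathcal X$ one has $\phi^{(\beta)}(x)\in\mathcal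 H$ and $D^\beta h(x)=\langle h,\phi^{(\beta)}(x)\rangle$ for all $h\in\mathcal H$; and the minimizers $h_\lambda,\hat h_\lambda$ exist and are unique. Moreover, fix $\alpha\in\mathcal A_s$ and a finite grid $\xi_1,\dots,\xi_n\in\mathcal X$, and let $\theta=[D^\alpha h_\lambda(\xi_j)]_{j=1}^n$, $\hat\theta=[D^\alpha\hat h_\lambda(\xi_j)]_{j=1}^n$ and $u_j=\Sigma_\lambda^{-1}\phi^{(\alpha)}(\xi_j)$. Then the matrix $\Omega_\lambda$ with entries $[\Omega_\lambda]_{kj}=\langle u_k,Q_\lambda u_j\rangle$ is positive semidefinite, and $$\sqrt N\,(\hat\theta-\theta)\ \xrightarrow{\ d\ }\ \mathcal N_n(0,\Omega_\lambda)\qquad(N\to\infty).$$ -/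

import Mathlib

open MeasureTheory ProbabilityTheory Filter Topology InnerProductSpace

namespace MeanVar

noncomputable section

/-! ### Functions on a subset of a Euclidean space, and their derivatives up to the boundary -/

/-- Extension by zero to the whole space of a real function given on a subset. Only its values near
interior points of the subset are ever differentiated. -/
def zeroExt {E : Type*} {S : Set E} (f : S → ℝ) : E → ℝ :=
  Function.extend Subtype.val f 0

/-- The class `C^m(S)`: `f` is continuous on `S`, it is `m` times continuously differentiable in the
interior of `S`, and its derivatives of order `k ≤ m` extend continuously from the interior to `S`.
For open `S` this is the usual class `C^m`. -/
def IsCk {E : Type*} [NormedAddCommGroup E] [NormedSpace ℝ E] (m : ℕ) {S : Set E}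
    (f : S → ℝ) : Prop :=
  Continuous f ∧ ContDiffOn ℝ m (zeroExt f) (interior S) ∧
    ∀ k : ℕ, k ≤ m → ∃ G : E → E [×k]→L[ℝ] ℝ,
      ContinuousOn G S ∧ Set.EqOn G (iteratedFDeriv ℝ k (zeroExt f)) (interior S)

/-- The partial derivative `∂f/∂x_i`. -/
def partialDeriv {d : ℕ} (i : Fin d) (f : EuclideanSpace ℝ (Fin d) → ℝ) :
    EuclideanSpace ℝ (Fin d) → ℝ :=
  fun x => lineDeriv ℝ f x (EuclideanSpace.single i 1)

/-- `∂^|α| f / ∂x_1^{α_1} ⋯ ∂x_d^{α_d}` for a function on the whole space. -/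
def multiDeriv {d : ℕ} (α : Fin d → ℕ) (f : EuclideanSpace ℝ (Fin d) → ℝ) :
    EuclideanSpace ℝ (Fin d) → ℝ :=
  (List.finRange d).foldr (fun i g => (partialDeriv i)^[α i] g) f

/-- `D^α f (x)` for a function `f` on `X` and a point `x` of `X`: the limit at `x` of the classical
partial derivative taken in the interior of `X`. For `f ∈ C^m(X)` and `|α| ≤ m`, this is the
classical partial derivative at interior points, and its continuous extension elsewhere. -/
def D {d : ℕ} {X : Set (EuclideanSpace ℝ (Fin d))} (α : Fin d → ℕ) (f : X → ℝ) (x : X) : ℝ :=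
  limUnder (𝓝[interior X] (x : EuclideanSpace ℝ (Fin d))) (multiDeriv α (zeroExt f))

/-- The multi-indices of order at most `s`. -/
def multiIdx (d s : ℕ) : Finset (Fin d → ℕ) :=
  (Fintype.piFinset fun _ => Finset.range (s + 1)).filter fun α => ∑ i, α i ≤ s

/-- A minimizer of `J` (if there is one). -/
def argmin {H : Type*} [Nonempty H] (J : H → ℝ) : H :=
  Classical.epsilon fun h => ∀ g, J h ≤ J g

/-! ### The kernel, and derivatives of the feature map -/

section Model

variable {d : ℕ} {X : Set (EuclideanSpace ℝ (Fin d))} {Y : Set ℝ}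
  (H : Type*) [NormedAddCommGroup H] [InnerProductSpace ℝ H] [CompleteSpace H] [RKHS ℝ H X ℝ]

/-- The reproducing kernel `K(x, y)` of `H`. -/
def kern (x y : X) : ℝ := RKHS.kernel H x y 1

/-- The reproducing kernel as a function on the subset `X × X` of the product space. -/
def kernProd (p : (X ×ˢ X : Set (EuclideanSpace ℝ (Fin d) × EuclideanSpace ℝ (Fin d)))) : ℝ :=
  kern H ⟨p.1.1, p.2.1⟩ ⟨p.1.2, p.2.2⟩

/-- `φ^(α)(x) = D^α K(x, ·)`, the element of `H` whose value at `y` is the `α`-derivative at `x`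
of `K(·, y)`. -/
def featDeriv (α : Fin d → ℕ) (x : X) : H :=
  Classical.epsilon fun g : H => ∀ y : X, g y = D α (fun x' => kern H x' y) x

/-- `ψ(z) = ∑_{|α| ≤ s} w_α(z) φ^(α)(x)` for `z = (x, y)`. -/
def psi (s : ℕ) (w : (Fin d → ℕ) → X × Y → ℝ) (z : X × Y) : H :=
  ∑ α ∈ multiIdx d s, w α z • featDeriv H α z.1

variable {H}

/-- The target functional `R(h; z) = ∑_{|α| ≤ s} w_α(z) D^α h(x)` for `z = (x, y)`. -/
def target (s : ℕ) (w : (Fin d → ℕ) → X × Y → ℝ) (h : H) (z : X × Y) : ℝ :=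
  ∑ α ∈ multiIdx d s, w α z * D α (fun x => h x) z.1

/-! ### The population and the empirical problem -/

/-- `J_λ(h) = - E[R(h; z)] + V[R(h; z)] / 2 + λ ‖h‖² / 2`, with `z ∼ P`. -/
def popObjective (s : ℕ) (w : (Fin d → ℕ) → X × Y → ℝ) (P : Measure (X × Y)) (lam : ℝ)
    (h : H) : ℝ :=
  -(∫ z, target s w h z ∂P) + 1 / 2 * Var[target s w h; P] + lam / 2 * ‖h‖ ^ 2

/-- The mean of a finite sample `r 0, …, r (N - 1)`. -/
def sampleMean (N : ℕ) (r : ℕ → ℝ) : ℝ := (N : ℝ)⁻¹ * ∑ i ∈ Finset.range N, r i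

/-- The variance of the empirical distribution of `r 0, …, r (N - 1)`. -/
def sampleVar (N : ℕ) (r : ℕ → ℝ) : ℝ := sampleMean N fun i => (r i - sampleMean N r) ^ 2

/-- The objective `J_λ` with `P` replaced by the empirical distribution of `z 0, …, z (N - 1)`. -/
def empObjective (s : ℕ) (w : (Fin d → ℕ) → X × Y → ℝ) (N : ℕ) (z : ℕ → X × Y) (lam : ℝ)
    (h : H) : ℝ :=
  -sampleMean N (fun i => target s w h (z i))
    + 1 / 2 * sampleVar N (fun i => target s w h (z i)) + lam / 2 * ‖h‖ ^ 2

variable (H)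

/-- `h_λ = argmin J_λ`. -/
def hPop (s : ℕ) (w : (Fin d → ℕ) → X × Y → ℝ) (P : Measure (X × Y)) (lam : ℝ) : H :=
  argmin (popObjective s w P lam)

/-- `ĥ_λ`, the minimizer of the empirical objective. -/
def hEmp (s : ℕ) (w : (Fin d → ℕ) → X × Y → ℝ) (N : ℕ) (z : ℕ → X × Y) (lam : ℝ) : H :=
  argmin (empObjective s w N z lam)

/-! ### Moments and the asymptotic covariance -/

/-- `μ = E[ψ]`. -/
def meanPsi (s : ℕ) (w : (Fin d → ℕ) → X × Y → ℝ) (P : Measure (X × Y)) : H :=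
  ∫ z, psi H s w z ∂P

/-- `Σ = E[(ψ - μ) ⊗ (ψ - μ)]`, where `(f ⊗ g) u = ⟪u, g⟫ f`. -/
def covPsi (s : ℕ) (w : (Fin d → ℕ) → X × Y → ℝ) (P : Measure (X × Y)) : H →L[ℝ] H :=
  ∫ z, rankOne ℝ (psi H s w z - meanPsi H s w P) (psi H s w z - meanPsi H s w P) ∂P

/-- `Σ_λ = Σ + λ I`. -/
def covReg (s : ℕ) (w : (Fin d → ℕ) → X × Y → ℝ) (P : Measure (X × Y)) (lam : ℝ) : H →L[ℝ] H :=
  covPsi H s w P + lam • (1 : H →L[ℝ] H)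

/-- `F(z) = (ψ(z) - μ) - ((ψ(z) - μ) ⊗ (ψ(z) - μ) - Σ) h_λ`. -/
def influence (s : ℕ) (w : (Fin d → ℕ) → X × Y → ℝ) (P : Measure (X × Y)) (lam : ℝ)
    (z : X × Y) : H :=
  (psi H s w z - meanPsi H s w P)
    - (rankOne ℝ (psi H s w z - meanPsi H s w P) (psi H s w z - meanPsi H s w P)
        - covPsi H s w P) (hPop H s w P lam)

/-- `Q_λ = E[F ⊗ F]`. -/
def Q (s : ℕ) (w : (Fin d → ℕ) → X × Y → ℝ) (P : Measure (X × Y)) (lam : ℝ) : H →L[ℝ] H :=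
  ∫ z, rankOne ℝ (influence H s w P lam z) (influence H s w P lam z) ∂P

/-- `u_j = Σ_λ⁻¹ φ^(α)(ξ_j)`. -/
def uVec (s : ℕ) (w : (Fin d → ℕ) → X × Y → ℝ) (P : Measure (X × Y)) (lam : ℝ)
    (α : Fin d → ℕ) {n : ℕ} (ξ : Fin n → X) (j : Fin n) : H :=
  Ring.inverse (covReg H s w P lam) (featDeriv H α (ξ j))

/-- The matrix `Ω_λ` with entries `⟪u_k, Q_λ u_j⟫`. -/
def omegaMat (s : ℕ) (w : (Fin d → ℕ) → X × Y → ℝ) (P : Measure (X × Y)) (lam : ℝ)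
    (α : Fin d → ℕ) {n : ℕ} (ξ : Fin n → X) : Matrix (Fin n) (Fin n) ℝ :=
  Matrix.of fun k j =>
    inner ℝ (uVec H s w P lam α ξ k) (Q H s w P lam (uVec H s w P lam α ξ j))

variable {H}

/-- The vector of the derivatives `D^α h(ξ_1), …, D^α h(ξ_n)` on the grid. -/
def gridEval (α : Fin d → ℕ) {n : ℕ} (ξ : Fin n → X) (h : H) : EuclideanSpace ℝ (Fin n) :=
  WithLp.toLp 2 fun j => D α (fun x => h x) (ξ j)

end Model

end

end MeanVar

/-! The proof has an analytic half and a statistical half. Analytic half. Since `⟪K(x,·), K(y,·)⟫ =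
K(x, y)`, inner products of difference quotients of the feature map `x ↦ K(x,·)` are second
difference quotients of `K`. These converge when `K` is `C²`, and convergence of all mutual inner
products to one number makes a family Cauchy (`exists_tendsto_of_tendsto_inner`). By induction a
`C^{2s}` kernel gives a `C^s` feature map up to the boundary (`ckUpTo_of_gram`). Hence `D^β h(x) =
⟪h, φ^(β)(x)⟫` and `R(h; z) = ⟪h, ψ(z)⟫`, so both problems are strictly convex quadratics, solved by
`(S + λ)⁻¹ m` with `(S, m)` the population or sample covariance and mean (`IsCovOp.argmin_eq`).
Statistical half. With hats for sample quantities, `(Σ̂ + λ)(ĥ - h)` equals the sample mean of `F`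
plus a term quadratic in `μ̂ - μ` (`reg_apply_sub`). Pairing with `Σ_λ⁻¹ φ` writes `⟪ĥ - h, φ⟫` as
`⟪mean of F, Σ_λ⁻¹ φ⟫` plus a remainder (`inner_regSol_sub`). Each remainder term is a factor of
order `N^{-1/2}` in probability times one that tends to zero, so it vanishes after scaling by `√N`
(`tendstoInMeasure_remainder`). The linear term obeys the scalar central limit theorem, and
Cramér-Wold passes from scalars to the grid, a linear combination of grid values being the pairing
with one vector `φ = ∑ t_j φ^(α)(ξ_j)`. -/

namespace MeanVar

/-! ### Functions with derivatives that extend continuously to a larger set -/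

section CkUpTo

variable {E F F' : Type*} [NormedAddCommGroup E] [NormedSpace ℝ E] [NormedAddCommGroup F]
  [NormedSpace ℝ F] [NormedAddCommGroup F'] [NormedSpace ℝ F']

/-- `f` is `C^k` on `U`, and its derivatives of order at most `k` have limits, within `U`, at all
points of `X`. -/
def CkUpTo (k : ℕ) (U X : Set E) (f : E → F) : Prop :=
  ContDiffOn ℝ k f U ∧
    ∀ j ≤ k, ∀ x ∈ X, ∃ l, Tendsto (iteratedFDeriv ℝ j f) (𝓝[U] x) (𝓝 l)

variable {k : ℕ} {U X : Set E} {f g : E → F}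

lemma CkUpTo.exists_tendsto (hf : CkUpTo k U X f) {x : E} (hx : x ∈ X) :
    ∃ l, Tendsto f (𝓝[U] x) (𝓝 l) := by
  obtain ⟨l, hl⟩ := hf.2 0 k.zero_le x hx
  refine ⟨continuousMultilinearCurryFin0 ℝ E F l, ?_⟩
  refine (((continuousMultilinearCurryFin0 ℝ E F).continuous.tendsto l).comp hl).congr fun y => ?_
  simp

lemma ckUpTo_zero (hf : ContinuousOn f U) (h : ∀ x ∈ X, ∃ l, Tendsto f (𝓝[U] x) (𝓝 l)) :
    CkUpTo 0 U X f := by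
  refine ⟨by exact_mod_cast (contDiffOn_zero (𝕜 := ℝ)).2 hf, fun j hj x hx => ?_⟩
  obtain rfl : j = 0 := by omega
  obtain ⟨l, hl⟩ := h x hx
  refine ⟨(continuousMultilinearCurryFin0 ℝ E F).symm l, ?_⟩
  rw [iteratedFDeriv_zero_eq_comp]
  exact ((continuousMultilinearCurryFin0 ℝ E F).symm.continuous.tendsto l).comp hl

lemma CkUpTo.mono_order (hf : CkUpTo k U X f) {j : ℕ} (hj : j ≤ k) : CkUpTo j U X f :=
  ⟨hf.1.of_le (by exact_mod_cast hj), fun i hi => hf.2 i (hi.trans hj)⟩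

/-- The limits at points of `X` are taken within the open set `U`, so values off `U` play no role.
-/
lemma CkUpTo.congr (hU : IsOpen U) (hf : CkUpTo k U X f) (h : Set.EqOn g f U) :
    CkUpTo k U X g := by
  refine ⟨hf.1.congr h, fun j hj x hx => ?_⟩
  obtain ⟨l, hl⟩ := hf.2 j hj x hx
  refine ⟨l, hl.congr' ?_⟩
  filter_upwards [self_mem_nhdsWithin] with y hy
  exact ((h.eventuallyEq_of_mem (hU.mem_nhds hy)).iteratedFDeriv ℝ j).eq_of_nhds.symm

lemma CkUpTo.clm_comp (hU : IsOpen U) (hf : CkUpTo k U X f) (T : F →L[ℝ] F') :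
    CkUpTo k U X (fun x => T (f x)) := by
  refine ⟨T.contDiff.comp_contDiffOn hf.1, fun j hj x hx => ?_⟩
  obtain ⟨l, hl⟩ := hf.2 j hj x hx
  refine ⟨T.compContinuousMultilinearMap l,
    (((ContinuousLinearMap.compContinuousMultilinearMapL ℝ (fun _ : Fin j => E) F F' T).continuous.tendsto
      l).comp hl).congr' ?_⟩
  filter_upwards [self_mem_nhdsWithin] with y hy
  exact (T.iteratedFDeriv_comp_left (hf.1.contDiffAt (hU.mem_nhds hy))
    (by exact_mod_cast hj)).symm

lemma CkUpTo.add (hU : IsOpen U) (hf : CkUpTo k U X f) (hg : CkUpTo k U X g) :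
    CkUpTo k U X (fun x => f x + g x) := by
  refine ⟨hf.1.add hg.1, fun j hj x hx => ?_⟩
  obtain ⟨l, hl⟩ := hf.2 j hj x hx
  obtain ⟨m, hm⟩ := hg.2 j hj x hx
  refine ⟨l + m, (hl.add hm).congr' ?_⟩
  filter_upwards [self_mem_nhdsWithin] with y hy
  have h1 := (hf.1.contDiffAt (hU.mem_nhds hy)).of_le (show (j : WithTop ℕ∞) ≤ k by exact_mod_cast hj)
  have h2 := (hg.1.contDiffAt (hU.mem_nhds hy)).of_le (show (j : WithTop ℕ∞) ≤ k by exact_mod_cast hj)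
  exact (iteratedFDeriv_add_apply h1 h2).symm

lemma CkUpTo.zero_fun : CkUpTo k U X (fun _ => (0 : F)) := by
  refine ⟨contDiffOn_const, fun j _ x _ => ⟨0, ?_⟩⟩
  have : iteratedFDeriv ℝ j (fun _ : E => (0 : F)) = 0 := iteratedFDeriv_fun_zero
  rw [this]
  exact tendsto_const_nhds

lemma CkUpTo.sum (hU : IsOpen U) {ι : Type*} (I : Finset ι) {f : ι → E → F}
    (hf : ∀ i ∈ I, CkUpTo k U X (f i)) : CkUpTo k U X (fun x => ∑ i ∈ I, f i x) := by
  classical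
  induction I using Finset.induction_on with
  | empty => simpa using CkUpTo.zero_fun
  | insert a I ha ih =>
    simp only [Finset.sum_insert ha]
    exact (hf a (by simp)).add hU (ih fun i hi => hf i (by simp [hi]))

lemma CkUpTo.ckUpTo_fderiv (hU : IsOpen U) (hf : CkUpTo (k + 1) U X f) :
    CkUpTo k U X (fderiv ℝ f) := by
  refine ⟨((contDiffOn_succ_iff_fderiv_of_isOpen hU).1 (by exact_mod_cast hf.1)).2.2,
    fun j hj x hx => ?_⟩
  obtain ⟨l, hl⟩ := hf.2 (j + 1) (by omega) x hx
  refine ⟨continuousMultilinearCurryRightEquiv' ℝ j E F l, ?_⟩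
  have := ((continuousMultilinearCurryRightEquiv' ℝ j E F).continuous.tendsto l).comp hl
  refine this.congr fun y => ?_
  rw [Function.comp_apply, iteratedFDeriv_succ_eq_comp_right, Function.comp_apply,
    LinearIsometryEquiv.apply_symm_apply]

lemma CkUpTo.of_fderiv (hU : IsOpen U) (h0 : ∀ x ∈ X, ∃ l, Tendsto f (𝓝[U] x) (𝓝 l))
    (hd : DifferentiableOn ℝ f U) (hf : CkUpTo k U X (fderiv ℝ f)) : CkUpTo (k + 1) U X f := by
  refine ⟨?_, fun j hj x hx => ?_⟩
  · have : ContDiffOn ℝ ((k : WithTop ℕ∞) + 1) f U :=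
      (contDiffOn_succ_iff_fderiv_of_isOpen hU).2 ⟨hd, by simp, hf.1⟩
    exact_mod_cast this
  · rcases j with _ | j
    · exact (ckUpTo_zero hd.continuousOn h0).2 0 le_rfl x hx
    · obtain ⟨l, hl⟩ := hf.2 j (by omega) x hx
      refine ⟨(continuousMultilinearCurryRightEquiv' ℝ j E F).symm l, ?_⟩
      refine (((continuousMultilinearCurryRightEquiv' ℝ j E F).symm.continuous.tendsto l).comp
        hl).congr fun y => ?_
      rw [iteratedFDeriv_succ_eq_comp_right]

lemma CkUpTo.differentiableOn (hf : CkUpTo (k + 1) U X f) :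
    DifferentiableOn ℝ f U := hf.1.differentiableOn (by simp)

/-- In finite dimension, regularity of a map into linear maps can be checked pointwise. -/
lemma CkUpTo.of_clm_apply [FiniteDimensional ℝ E] {G : Type*} [NormedAddCommGroup G]
    [NormedSpace ℝ G] {U X : Set G} (hU : IsOpen U) {L : G → E →L[ℝ] F}
    (h : ∀ v, CkUpTo k U X (fun x => L x v)) : CkUpTo k U X L := by
  let b := Module.finBasis ℝ E
  have key : L = fun x => ∑ i, ContinuousLinearMap.smulRightL ℝ E F
      (LinearMap.toContinuousLinearMap (b.coord i)) (L x (b i)) := by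
    ext x v
    conv_lhs => rw [← b.sum_repr v, map_sum]
    simp
  rw [key]
  exact CkUpTo.sum hU _ fun i _ => (h (b i)).clm_comp hU _

end CkUpTo

/-! ### Regularity of a map into a Hilbert space from regularity of its Gram kernel -/

section Gram

variable {E H : Type*} [NormedAddCommGroup E] [NormedSpace ℝ E] [NormedAddCommGroup H]
  [InnerProductSpace ℝ H]

/-- Expanding, `‖a q - a p‖² = ⟪a q, a q⟫ - 2⟪a p, a q⟫ + ⟪a p, a p⟫ → c - 2c + c = 0`, so the
family is Cauchy. -/
lemma exists_tendsto_of_tendsto_inner [CompleteSpace H] {ι : Type*} {l : Filter ι} [l.NeBot]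
    {a : ι → H} {c : ℝ}
    (h : Tendsto (fun p : ι × ι => inner ℝ (a p.1) (a p.2)) (l ×ˢ l) (𝓝 c)) :
    ∃ L, Tendsto a l (𝓝 L) := by
  refine cauchy_map_iff_exists_tendsto.1 (cauchy_map_iff.2 ⟨inferInstance, ?_⟩)
  rw [uniformity_eq_comap_nhds_zero, tendsto_comap_iff, tendsto_zero_iff_norm_tendsto_zero]
  have h1 : Tendsto (fun p : ι × ι => inner ℝ (a p.1) (a p.1)) (l ×ˢ l) (𝓝 c) :=
    h.comp (tendsto_fst.prodMk tendsto_fst)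
  have h2 : Tendsto (fun p : ι × ι => inner ℝ (a p.2) (a p.2)) (l ×ˢ l) (𝓝 c) :=
    h.comp (tendsto_snd.prodMk tendsto_snd)
  have h3 : Tendsto (fun p : ι × ι => √(inner ℝ (a p.2) (a p.2) - 2 * inner ℝ (a p.1) (a p.2)
      + inner ℝ (a p.1) (a p.1))) (l ×ˢ l) (𝓝 0) := by
    have := (((h2.sub (h.const_mul 2)).add h1)).sqrt
    convert this using 2
    rw [show c - 2 * c + c = 0 by ring, Real.sqrt_zero]
  refine h3.congr fun p => ?_
  have := norm_sub_sq_real (a p.2) (a p.1)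
  rw [← real_inner_self_eq_norm_sq (a p.2), ← real_inner_self_eq_norm_sq (a p.1),
    real_inner_comm (a p.1) (a p.2)] at this
  rw [← this, Real.sqrt_sq (norm_nonneg _), Function.comp_apply]

lemma ckUpTo_zero_of_gram [CompleteSpace H] {U X : Set E} (hU : IsOpen U) (hUX : U ⊆ X)
    (hX : X ⊆ closure U) {f : E → H}
    (hk : CkUpTo 0 (U ×ˢ U) (X ×ˢ X) fun p : E × E => (inner ℝ (f p.1) (f p.2) : ℝ)) :
    CkUpTo 0 U X f := by
  have hlim : ∀ x ∈ X, ∃ l, Tendsto f (𝓝[U] x) (𝓝 l) := by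
    intro x hx
    obtain ⟨c, hc⟩ := hk.exists_tendsto (x := (x, x)) ⟨hx, hx⟩
    rw [nhdsWithin_prod_eq] at hc
    have : (𝓝[U] x).NeBot := mem_closure_iff_nhdsWithin_neBot.1 (hX hx)
    exact exists_tendsto_of_tendsto_inner hc
  refine ckUpTo_zero (fun x hx => ?_) hlim
  obtain ⟨l, hl⟩ := hlim x (hUX hx)
  rw [hU.nhdsWithin_eq hx] at hl
  -- The neighbourhood is not punctured, so the limit must be the value at `x`.
  have : l = f x := tendsto_nhds_unique (hl.mono_left (pure_le_nhds x)) (tendsto_pure_nhds f x)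
  exact (this ▸ hl : Tendsto f (𝓝 x) (𝓝 (f x))).mono_left nhdsWithin_le_nhds

/-- The inner product of the difference quotients with steps `t` and `r` is a mixed second
difference quotient of the kernel. It tends to the mixed second derivative as `t` and `r` tend to
zero independently, so the difference quotients converge in `H`. -/
lemma exists_hasLineDerivAt_of_gram [CompleteSpace H] {f : E → H} {x : E}
    (hk : ContDiffAt ℝ 2 (fun p : E × E => (inner ℝ (f p.1) (f p.2) : ℝ)) (x, x)) (v : E) :
    ∃ L, HasLineDerivAt ℝ f L x v := by
  set k : E × E → ℝ := fun p => inner ℝ (f p.1) (f p.2) with hkdef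
  let f1 : E × E → ℝ := fun p => fderiv ℝ k p (v, 0)
  have hf1 : HasStrictFDerivAt f1 (fderiv ℝ f1 (x, x)) (x, x) := by
    have : ContDiffAt ℝ 1 f1 (x, x) :=
      (hk.fderiv_right (m := 1) (by norm_num)).clm_apply contDiffAt_const
    exact this.hasStrictFDerivAt (by norm_num)
  set A := fderiv ℝ f1 (x, x)
  have hdiff : ∀ᶠ p in 𝓝 (x, x), DifferentiableAt ℝ k p := by
    filter_upwards [hk.eventually (by simp)] with p hp
    exact hp.differentiableAt (by simp)
  set a : ℝ → H := fun t => t⁻¹ • (f (x + t • v) - f x)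
  have key : Tendsto (fun p : ℝ × ℝ => inner ℝ (a p.1) (a p.2)) (𝓝[≠] 0 ×ˢ 𝓝[≠] 0)
      (𝓝 (A (0, v))) := by
    rw [Metric.tendsto_nhds]
    intro ε hε
    obtain ⟨η, hη, hηε⟩ : ∃ η > 0, η * ‖v‖ < ε :=
      -- The `+ 1` covers `v = 0`.
      ⟨ε / (‖v‖ + 1), by positivity, by
        rw [div_mul_eq_mul_div, div_lt_iff₀ (by positivity)]; nlinarith [norm_nonneg v]⟩
    set p : ℝ × ℝ → E × E := fun q => (x + q.1 • v, x + q.2 • v) with hp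
    set p' : ℝ × ℝ → E × E := fun q => (x + q.1 • v, x) with hp'
    have hpc : Tendsto p (𝓝 (0, 0)) (𝓝 (x, x)) :=
      (by fun_prop : Continuous p).tendsto' _ _ (by simp [hp])
    have hpc' : Tendsto p' (𝓝 (0, 0)) (𝓝 (x, x)) :=
      (by fun_prop : Continuous p').tendsto' _ _ (by simp [hp'])
    -- Strict differentiability is essential: it compares `f1` at two points that both move, `p` and
    -- `p'`.
    have hs := (hpc.prodMk_nhds hpc').eventually (hf1.isLittleO.def hη)
    obtain ⟨δ, hδ, hball⟩ := Metric.eventually_nhds_iff_ball.1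
      (hs.and ((hpc.eventually hdiff).and (hpc'.eventually hdiff)))
    have hmem : ∀ {t r : ℝ}, t ∈ Metric.ball (0 : ℝ) δ → r ∈ Metric.ball (0 : ℝ) δ →
        (t, r) ∈ Metric.ball ((0, 0) : ℝ × ℝ) δ := fun ht hr => by
      rw [← ball_prod_same]; exact ⟨ht, hr⟩
    have hnhds : Metric.ball (0 : ℝ) δ ∈ 𝓝[≠] (0 : ℝ) :=
      mem_nhdsWithin_of_mem_nhds (Metric.ball_mem_nhds _ hδ)
    filter_upwards [Filter.prod_mem_prod (Filter.inter_mem hnhds self_mem_nhdsWithin)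
      (Filter.inter_mem hnhds self_mem_nhdsWithin)]
    rintro ⟨t, r⟩ ⟨⟨ht, ht0⟩, ⟨hr, hr0⟩⟩
    have ht0 : t ≠ 0 := ht0
    have hr0 : r ≠ 0 := hr0
    -- `G t - G 0` is the mixed second difference minus its expected value `t r A(0, v)`. The mean
    -- value inequality in `τ` bounds it by `η |r| ‖v‖ |t|`, which survives division by `|t r|`.
    let G : ℝ → ℝ := fun τ => k (p (τ, r)) - k (p' (τ, r)) - τ * (r * A (0, v))
    have hG : ∀ τ ∈ Metric.ball (0 : ℝ) δ, HasDerivWithinAt G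
        (f1 (p (τ, r)) - f1 (p' (τ, r)) - 1 * (r * A (0, v))) (Metric.ball 0 δ) τ := by
      intro τ hτ
      obtain ⟨-, hd1, hd2⟩ := hball _ (hmem hτ hr)
      have hp1 : HasDerivAt (fun τ : ℝ => p (τ, r)) (v, 0) τ := by
        refine HasDerivAt.prodMk ?_ (hasDerivAt_const τ (x + r • v))
        simpa using ((hasDerivAt_id τ).smul_const v).const_add x
      have hp2 : HasDerivAt (fun τ : ℝ => p' (τ, r)) (v, 0) τ := by
        refine HasDerivAt.prodMk ?_ (hasDerivAt_const _ _)
        simpa using ((hasDerivAt_id τ).smul_const v).const_add x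
      exact (((hd1.hasFDerivAt.comp_hasDerivAt τ hp1).sub
        (hd2.hasFDerivAt.comp_hasDerivAt τ hp2)).sub
        ((hasDerivAt_id τ).mul_const _)).hasDerivWithinAt
    have hbound : ∀ τ ∈ Metric.ball (0 : ℝ) δ,
        ‖f1 (p (τ, r)) - f1 (p' (τ, r)) - 1 * (r * A (0, v))‖ ≤ η * (|r| * ‖v‖) := by
      intro τ hτ
      obtain ⟨h1, -, -⟩ := hball _ (hmem hτ hr)
      have hpp : p (τ, r) - p' (τ, r) = r • ((0, v) : E × E) := by simp [hp, hp']
      simp only [hpp, map_smul, smul_eq_mul] at h1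
      simpa [norm_smul, max_eq_right (mul_nonneg (abs_nonneg r) (norm_nonneg v))] using h1
    have hmvt := (convex_ball (0 : ℝ) δ).norm_image_sub_le_of_norm_hasDerivWithin_le hG hbound
      (Metric.mem_ball_self hδ) ht
    have hin : inner ℝ (a t) (a r) - A (0, v) = (t * r)⁻¹ * (G t - G 0) := by
      simp only [a, G, hkdef, hp, hp', inner_smul_left, inner_smul_right, inner_sub_left,
        inner_sub_right, zero_smul, add_zero]
      simp only [map_inv₀, conj_trivial]
      field_simp
      ring
    rw [Real.dist_eq]
    simp only [hin]
    rw [abs_mul, abs_inv, abs_mul]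
    rw [sub_zero, Real.norm_eq_abs, Real.norm_eq_abs] at hmvt
    have h1 : 0 < |t| := abs_pos.2 ht0
    have h2 : 0 < |r| := abs_pos.2 hr0
    calc (|t| * |r|)⁻¹ * |G t - G 0| ≤ (|t| * |r|)⁻¹ * (η * (|r| * ‖v‖) * |t|) := by gcongr
      _ = η * ‖v‖ := by field_simp
      _ < ε := hηε
  obtain ⟨L, hL⟩ := exists_tendsto_of_tendsto_inner key
  refine ⟨L, ?_⟩
  rw [HasLineDerivAt, hasDerivAt_iff_tendsto_slope_zero]
  simpa [a] using hL

lemma hasLineDerivAt_of_gram [CompleteSpace H] {U : Set E} (hU : IsOpen U)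
    {f : E → H} (hk : ContDiffOn ℝ 2 (fun p : E × E => (inner ℝ (f p.1) (f p.2) : ℝ)) (U ×ˢ U))
    {x : E} (hx : x ∈ U) (v : E) : HasLineDerivAt ℝ f (lineDeriv ℝ f x v) x v := by
  obtain ⟨L, hL⟩ := exists_hasLineDerivAt_of_gram
    (hk.contDiffAt ((hU.prod hU).mem_nhds ⟨hx, hx⟩)) v
  exact hL.lineDifferentiableAt.hasLineDerivAt

lemma inner_lineDeriv_of_gram {f : E → H} {k : E × E → ℝ} {x y : E}
    (hk : ∀ᶠ x' in 𝓝 x, inner ℝ (f x') (f y) = k (x', y)) (hd : DifferentiableAt ℝ k (x, y))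
    {v L : _} (hL : HasLineDerivAt ℝ f L x v) : inner ℝ L (f y) = fderiv ℝ k (x, y) (v, 0) := by
  have e1 : HasDerivAt (fun t : ℝ => (inner ℝ (f (x + t • v)) (f y) : ℝ)) (inner ℝ L (f y)) 0 := by
    simpa using HasDerivAt.inner ℝ hL (hasDerivAt_const (0 : ℝ) (f y))
  have e2 : HasDerivAt (fun t : ℝ => ((x + t • v, y) : E × E)) (v, 0) 0 := by
    refine HasDerivAt.prodMk ?_ (hasDerivAt_const _ _)
    simpa using ((hasDerivAt_id (0 : ℝ)).smul_const v).const_add x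
  have e3 : HasFDerivAt k (fderiv ℝ k (x, y)) (x + (0 : ℝ) • v, y) := by
    simpa using hd.hasFDerivAt
  have e4 := e3.comp_hasDerivAt (0 : ℝ) e2
  refine e1.unique (e4.congr_of_eventuallyEq ?_)
  have : Tendsto (fun t : ℝ => x + t • v) (𝓝 0) (𝓝 x) :=
    (by fun_prop : Continuous fun t : ℝ => x + t • v).tendsto' _ _ (by simp)
  exact this.eventually hk

lemma inner_lineDeriv_lineDeriv_of_gram [CompleteSpace H] {U : Set E} (hU : IsOpen U)
    {f : E → H} {k : E × E → ℝ} (hkf : k = fun p => inner ℝ (f p.1) (f p.2))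
    (hk : ContDiffOn ℝ 2 k (U ×ˢ U)) {x y : E} (hx : x ∈ U) (hy : y ∈ U) (v w : E) :
    inner ℝ (lineDeriv ℝ f x v) (lineDeriv ℝ f y w)
      = fderiv ℝ (fderiv ℝ k) (x, y) (0, w) (v, 0) := by
  have hkat : ∀ {x y}, x ∈ U → y ∈ U → ContDiffAt ℝ 2 k (x, y) := fun hx hy =>
    hk.contDiffAt ((hU.prod hU).mem_nhds ⟨hx, hy⟩)
  have hdx := hasLineDerivAt_of_gram hU (hkf ▸ hk) hx v
  have hdy := hasLineDerivAt_of_gram hU (hkf ▸ hk) hy w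
  have e1 : HasDerivAt (fun t : ℝ => (inner ℝ (lineDeriv ℝ f x v) (f (y + t • w)) : ℝ))
      (inner ℝ (lineDeriv ℝ f x v) (lineDeriv ℝ f y w)) 0 := by
    simpa using HasDerivAt.inner ℝ (hasDerivAt_const (0 : ℝ) (lineDeriv ℝ f x v)) hdy
  have e2 : HasDerivAt (fun t : ℝ => ((x, y + t • w) : E × E)) (0, w) 0 := by
    refine HasDerivAt.prodMk (hasDerivAt_const _ _) ?_
    simpa using ((hasDerivAt_id (0 : ℝ)).smul_const w).const_add y
  have e3 : HasFDerivAt (fun q => fderiv ℝ k q (v, 0))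
      ((ContinuousLinearMap.apply ℝ ℝ ((v, 0) : E × E)).comp (fderiv ℝ (fderiv ℝ k) (x, y)))
      (x, y + (0 : ℝ) • w) := by
    have h := (((hkat hx hy).fderiv_right (m := 1) (by norm_num)).differentiableAt
        (by simp)).hasFDerivAt
    rw [zero_smul, add_zero]
    exact (ContinuousLinearMap.apply ℝ ℝ ((v, 0) : E × E)).hasFDerivAt.comp (x, y) h
  have e4 := e3.comp_hasDerivAt (0 : ℝ) e2
  refine e1.unique (e4.congr_of_eventuallyEq ?_)
  have : Tendsto (fun t : ℝ => y + t • w) (𝓝 0) (𝓝 y) :=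
    (by fun_prop : Continuous fun t : ℝ => y + t • w).tendsto' _ _ (by simp)
  filter_upwards [this.eventually (hU.mem_nhds hy)] with t ht
  exact inner_lineDeriv_of_gram (Eventually.of_forall fun x' => by rw [hkf])
    ((hkat hx ht).differentiableAt (by simp)) hdx

/-- A function whose derivatives along lines are given by a continuous family of linear maps is
differentiable. -/
lemma hasFDerivAt_of_hasLineDerivAt {U : Set E} (hU : IsOpen U) {f : E → H} {L : E → E →L[ℝ] H}
    (hd : ∀ x ∈ U, ∀ v, HasLineDerivAt ℝ f (L x v) x v) (hLc : ContinuousOn L U) {x : E}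
    (hx : x ∈ U) : HasFDerivAt f (L x) x := by
  rw [hasFDerivAt_iff_isLittleO, Asymptotics.isLittleO_iff]
  intro ε hε
  have hcont : ∀ᶠ y in 𝓝 x, ‖L y - L x‖ ≤ ε := by
    have := (hLc.continuousAt (hU.mem_nhds hx)).eventually (Metric.closedBall_mem_nhds (L x) hε)
    filter_upwards [this] with y hy
    rwa [← dist_eq_norm]
  obtain ⟨δ, hδ, hball⟩ := Metric.eventually_nhds_iff_ball.1 (hcont.and (hU.mem_nhds hx))
  filter_upwards [Metric.ball_mem_nhds x hδ] with y hy
  have hseg : ∀ t ∈ Set.Icc (0 : ℝ) 1, x + t • (y - x) ∈ Metric.ball x δ := fun t ht =>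
    (convex_ball x δ).add_smul_sub_mem (Metric.mem_ball_self hδ) hy ht
  -- Along the segment from `x` to `y`, the linear approximation is subtracted; the remaining
  -- derivative has norm at most `ε ‖y - x‖`.
  have hderiv : ∀ t ∈ Set.Icc (0 : ℝ) 1, HasDerivWithinAt
      (fun t : ℝ => f (x + t • (y - x)) - t • L x (y - x))
      (L (x + t • (y - x)) (y - x) - (1 : ℝ) • L x (y - x)) (Set.Icc 0 1) t := by
    intro t ht
    have hxt := (hball _ (hseg t ht)).2
    have e1 : HasDerivAt (fun t : ℝ => f (x + t • (y - x))) (L (x + t • (y - x)) (y - x)) t := by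
      have h3 := HasDerivAt.scomp_of_eq (h := fun u : ℝ => u - t) (h' := 1) t (hd _ hxt (y - x))
        ((hasDerivAt_id t).sub_const t) (by simp)
      rw [one_smul] at h3
      refine h3.congr_of_eventuallyEq (Eventually.of_forall fun u => ?_)
      simp only [Function.comp_apply]
      congr 1
      rw [add_assoc, ← add_smul]
      simp
    exact (e1.sub ((hasDerivAt_id t).smul_const _)).hasDerivWithinAt
  have := (convex_Icc (0 : ℝ) 1).norm_image_sub_le_of_norm_hasDerivWithin_le
    (C := ε * ‖y - x‖) hderiv (fun t ht => by
      rw [one_smul, ← _root_.sub_apply]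
      exact ((L (x + t • (y - x)) - L x).le_opNorm _).trans
        (by gcongr; exact (hball _ (hseg t ht)).1))
    (Set.left_mem_Icc.2 zero_le_one) (Set.right_mem_Icc.2 zero_le_one)
  simpa [sub_right_comm] using this

/-- Inner products of line derivatives are second derivatives of `k`, which are bilinear and
continuous. Bilinearity makes the additivity defect have norm zero; continuity makes the resulting
linear maps depend continuously on `x`, which upgrades line derivatives to a Fréchet derivative. -/
lemma fderiv_of_gram [CompleteSpace H] [FiniteDimensional ℝ E] {U : Set E} (hU : IsOpen U)
    {f : E → H} {k : E × E → ℝ} (hkf : k = fun p => inner ℝ (f p.1) (f p.2))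
    (hk : ContDiffOn ℝ 2 k (U ×ˢ U)) :
    DifferentiableOn ℝ f U ∧ ∀ x ∈ U, ∀ y ∈ U, ∀ v w,
      (inner ℝ (fderiv ℝ f x v) (fderiv ℝ f y w) : ℝ) =
        fderiv ℝ (fderiv ℝ k) (x, y) (0, w) (v, 0) := by
  have hUU : IsOpen (U ×ˢ U) := hU.prod hU
  have h2 : ∀ {x y}, x ∈ U → y ∈ U → ∀ v w, (inner ℝ (lineDeriv ℝ f x v) (lineDeriv ℝ f y w) : ℝ)
      = fderiv ℝ (fderiv ℝ k) (x, y) (0, w) (v, 0) :=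
    fun hx hy => inner_lineDeriv_lineDeriv_of_gram hU hkf hk hx hy
  have hlin : ∀ {x}, x ∈ U → ∀ v w, lineDeriv ℝ f x (v + w) = lineDeriv ℝ f x v + lineDeriv ℝ f x w := by
    intro x hx v w
    rw [← sub_eq_zero, ← inner_self_eq_zero (𝕜 := ℝ)]
    simp only [inner_sub_left, inner_sub_right, inner_add_left, inner_add_right, h2 hx hx]
    have a1 : ((v + w, 0) : E × E) = (v, 0) + (w, 0) := by simp
    have a2 : ((0, v + w) : E × E) = (0, v) + (0, w) := by simp
    simp only [a1, a2, map_add, _root_.add_apply]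
    ring
  classical
  let L : E → E →L[ℝ] H := fun x => if hx : x ∈ U then LinearMap.toContinuousLinearMap
    { toFun := lineDeriv ℝ f x
      map_add' := hlin hx
      map_smul' := fun c v => by simpa using lineDeriv_smul (𝕜 := ℝ) (f := f) (x := x) (v := v) (c := c) }
    else 0
  have hL : ∀ {x}, x ∈ U → ∀ v, L x v = lineDeriv ℝ f x v := fun hx v => by simp [L, hx]
  have hLc : ContinuousOn L U := by
    refine continuousOn_clm_apply.2 fun v => ?_
    have hM : ContinuousOn (fun p => fderiv ℝ (fderiv ℝ k) p (0, v) (v, 0)) (U ×ˢ U) := by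
      have := ((hk.fderiv_of_isOpen hUU (m := 1) (by norm_num)).fderiv_of_isOpen hUU
        (m := 0) (by norm_num)).continuousOn
      fun_prop
    -- Continuity of `x ↦ L x v` is again read off from its own Gram kernel.
    have hM0 : CkUpTo 0 (U ×ˢ U) (U ×ˢ U) fun p : E × E => (inner ℝ (L p.1 v) (L p.2 v) : ℝ) :=
      (ckUpTo_zero hM fun p hp => ⟨_, hM p hp⟩).congr hUU fun p hp => by
        simp only [hL hp.1, hL hp.2, h2 hp.1 hp.2]
    exact (ckUpTo_zero_of_gram hU subset_rfl subset_closure hM0).1.continuousOn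
  have hF : ∀ {x}, x ∈ U → HasFDerivAt f (L x) x := fun hx =>
    hasFDerivAt_of_hasLineDerivAt hU
      (fun x hx v => hL hx v ▸ hasLineDerivAt_of_gram hU (hkf ▸ hk) hx v) hLc hx
  refine ⟨fun x hx => (hF hx).differentiableAt.differentiableWithinAt, fun x hx y hy v w => ?_⟩
  rw [(hF hx).fderiv, (hF hy).fderiv, hL hx, hL hy, h2 hx hy]

/-- If the Gram kernel `⟪f x, f y⟫` is `C^{2s}` up to the boundary, then `f` is `C^s` up to the
boundary. -/
theorem ckUpTo_of_gram [CompleteSpace H] [FiniteDimensional ℝ E] {U X : Set E} (hU : IsOpen U)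
    (hUX : U ⊆ X) (hX : X ⊆ closure U) (s : ℕ) {f : E → H}
    (hk : CkUpTo (2 * s) (U ×ˢ U) (X ×ˢ X) fun p : E × E => (inner ℝ (f p.1) (f p.2) : ℝ)) :
    CkUpTo s U X f := by
  have hUU : IsOpen (U ×ˢ U) := hU.prod hU
  induction s generalizing f with
  | zero => exact ckUpTo_zero_of_gram hU hUX hX hk
  | succ s ih =>
    obtain ⟨hd, hM⟩ := fderiv_of_gram hU rfl (hk.1.of_le (by norm_cast; omega))
    refine CkUpTo.of_fderiv hU
      (fun x hx => (ckUpTo_zero_of_gram hU hUX hX (hk.mono_order (by omega))).exists_tendsto hx) hd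
      (CkUpTo.of_clm_apply hU fun v => ih ?_)
    -- The Gram kernel of `x ↦ f'(x) v` is a mixed second derivative of the original kernel: two
    -- orders of the kernel, from `2(s + 1)` to `2s`, pay for one order of `f`.
    have h2 := (CkUpTo.ckUpTo_fderiv hUU
      (CkUpTo.ckUpTo_fderiv (k := 2 * s + 1) hUU (hk.mono_order (by omega))))
    have h3 := (h2.clm_comp hUU (ContinuousLinearMap.apply ℝ (E × E →L[ℝ] ℝ) ((0, v) : E × E))).clm_comp
      hUU (ContinuousLinearMap.apply ℝ ℝ ((v, 0) : E × E))
    exact h3.congr hUU fun p hp => hM p.1 hp.1 p.2 hp.2 v v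

end Gram

/-! ### Derivatives of the feature map, and the derivative reproducing property -/

section ZeroExt

variable {E : Type*} {S : Set E}

lemma zeroExt_of_mem (f : S → ℝ) {x : E} (hx : x ∈ S) : zeroExt f x = f ⟨x, hx⟩ :=
  Subtype.val_injective.extend_apply f 0 ⟨x, hx⟩

lemma zeroExt_of_notMem (f : S → ℝ) {x : E} (hx : x ∉ S) : zeroExt f x = 0 :=
  Function.extend_apply' _ _ _ (by rintro ⟨y, rfl⟩; exact hx y.2)

lemma IsCk.ckUpTo [NormedAddCommGroup E] [NormedSpace ℝ E] {m : ℕ} {f : S → ℝ} (hf : IsCk m f) :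
    CkUpTo m (interior S) S (zeroExt f) := by
  refine ⟨hf.2.1, fun j hj x hx => ?_⟩
  obtain ⟨G, hG, hGe⟩ := hf.2.2 j hj
  refine ⟨G x, ((hG x hx).mono_left (nhdsWithin_mono x interior_subset)).congr' ?_⟩
  filter_upwards [self_mem_nhdsWithin] with y hy using hGe hy

lemma CkUpTo.isCk [NormedAddCommGroup E] [NormedSpace ℝ E] (hS : S ⊆ closure (interior S)) {m : ℕ}
    {f : S → ℝ} (hc : Continuous f) (hf : CkUpTo m (interior S) S (zeroExt f)) : IsCk m f := by
  refine ⟨hc, hf.1, fun k hk =>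
    ⟨extendFrom (interior S) (iteratedFDeriv ℝ k (zeroExt f)),
      continuousOn_extendFrom hS (hf.2 k hk), fun x hx => ?_⟩⟩
  refine extendFrom_extends (fun y hy => ?_) x hx
  exact ((hf.1.contDiffAt (isOpen_interior.mem_nhds hy)).continuousAt_iteratedFDeriv
    (by exact_mod_cast hk)).continuousWithinAt

end ZeroExt

lemma continuous_of_continuous_gram {T H : Type*} [TopologicalSpace T] [NormedAddCommGroup H]
    [InnerProductSpace ℝ H] [CompleteSpace H] {F : T → H}
    (h : Continuous fun p : T × T => (inner ℝ (F p.1) (F p.2) : ℝ)) : Continuous F := by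
  refine continuous_iff_continuousAt.2 fun x => ?_
  have := h.tendsto (x, x)
  rw [nhds_prod_eq] at this
  obtain ⟨L, hL⟩ := exists_tendsto_of_tendsto_inner this
  have hx : L = F x := tendsto_nhds_unique (hL.mono_left (pure_le_nhds x)) (tendsto_pure_nhds F x)
  exact (hx ▸ hL : Tendsto F (𝓝 x) (𝓝 (F x)))

section Model

variable {d s : ℕ} {X : Set (EuclideanSpace ℝ (Fin d))} {H : Type*} [NormedAddCommGroup H]
  [InnerProductSpace ℝ H] [CompleteSpace H] [RKHS ℝ H X ℝ]

lemma inner_kerFun_one (h : H) (x : X) : inner ℝ h (RKHS.kerFun H x (1 : ℝ)) = h x := by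
  simp

lemma kern_eq_apply (x y : X) : kern H x y = RKHS.kerFun H y (1 : ℝ) x := by
  rw [kern, RKHS.kerFun_apply]

lemma kern_eq_inner (x y : X) :
    kern H x y = inner ℝ (RKHS.kerFun H x (1 : ℝ)) (RKHS.kerFun H y (1 : ℝ)) := by
  rw [real_inner_comm, inner_kerFun_one, kern_eq_apply]

variable (H X) in
/-- The feature map `x ↦ K(x, ·)`, extended by zero to the whole space. -/
noncomputable def featExt : EuclideanSpace ℝ (Fin d) → H :=
  Function.extend Subtype.val (fun x : X => RKHS.kerFun H x (1 : ℝ)) 0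

lemma featExt_of_mem {x : EuclideanSpace ℝ (Fin d)} (hx : x ∈ X) :
    featExt X H x = RKHS.kerFun H ⟨x, hx⟩ (1 : ℝ) :=
  Subtype.val_injective.extend_apply (fun x : X => RKHS.kerFun H x (1 : ℝ)) 0 ⟨x, hx⟩

lemma featExt_of_notMem {x : EuclideanSpace ℝ (Fin d)} (hx : x ∉ X) :
    featExt X H x = 0 :=
  Function.extend_apply' _ _ _ (by rintro ⟨y, rfl⟩; exact hx y.2)

lemma zeroExt_eq_inner (h : H) (x : EuclideanSpace ℝ (Fin d)) :
    zeroExt (fun x : X => h x) x = inner ℝ h (featExt X H x) := by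
  by_cases hx : x ∈ X
  · rw [zeroExt_of_mem _ hx, featExt_of_mem hx, inner_kerFun_one]
  · rw [zeroExt_of_notMem _ hx, featExt_of_notMem hx, inner_zero_right]

/-- The extension by zero of the kernel is the Gram kernel of the extended feature map everywhere,
which makes `ckUpTo_of_gram` applicable. -/
lemma zeroExt_kernProd (p : EuclideanSpace ℝ (Fin d) × EuclideanSpace ℝ (Fin d)) :
    zeroExt (kernProd (X := X) H) p = inner ℝ (featExt X H p.1) (featExt X H p.2) := by
  by_cases hp : p ∈ X ×ˢ X
  · rw [zeroExt_of_mem _ hp, featExt_of_mem hp.1, featExt_of_mem hp.2, ← kern_eq_inner]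
    rfl
  · rw [zeroExt_of_notMem _ hp]
    by_cases h1 : p.1 ∈ X
    · rw [featExt_of_notMem (fun h2 => hp ⟨h1, h2⟩), inner_zero_right]
    · rw [featExt_of_notMem h1, inner_zero_left]

lemma ckUpTo_featExt (hX : X ⊆ closure (interior X))
    (hK : IsCk (2 * s) (kernProd (X := X) H)) : CkUpTo s (interior X) X (featExt X H) := by
  refine ckUpTo_of_gram isOpen_interior interior_subset hX s ?_
  rw [← interior_prod_eq]
  exact hK.ckUpTo.congr isOpen_interior fun p _ => (zeroExt_kernProd p).symm

lemma continuous_kerFun (hK : Continuous (kernProd (X := X) H)) :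
    Continuous fun x : X => RKHS.kerFun H x (1 : ℝ) := by
  refine continuous_of_continuous_gram ?_
  have : Continuous fun p : X × X => kernProd (X := X) H ⟨(p.1.1, p.2.1), p.1.2, p.2.2⟩ :=
    hK.comp (by fun_prop)
  refine this.congr fun p => ?_
  exact kern_eq_inner p.1 p.2

theorem isCk_coe (hX : X ⊆ closure (interior X)) (hK : IsCk (2 * s) (kernProd (X := X) H)) (h : H) :
    IsCk s (fun x : X => h x) := by
  refine CkUpTo.isCk hX ?_ ?_
  · refine ((continuous_const (y := h)).inner (𝕜 := ℝ) (continuous_kerFun hK.1)).congr fun x => ?_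
    exact inner_kerFun_one h x
  · exact ((ckUpTo_featExt hX hK).clm_comp isOpen_interior (innerSL ℝ h)).congr isOpen_interior
      fun x _ => zeroExt_eq_inner h x

lemma partialDeriv_eq_inner {H : Type*} [NormedAddCommGroup H] [InnerProductSpace ℝ H]
    {U : Set (EuclideanSpace ℝ (Fin d))} (hU : IsOpen U)
    {g : EuclideanSpace ℝ (Fin d) → H} (hg : DifferentiableOn ℝ g U) (h : H)
    {F : EuclideanSpace ℝ (Fin d) → ℝ} (hF : ∀ x ∈ U, F x = inner ℝ h (g x)) (i : Fin d) :
    ∀ x ∈ U, partialDeriv i F x = inner ℝ h (fderiv ℝ g x (EuclideanSpace.single i 1)) := by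
  intro x hx
  have h1 : HasFDerivAt (fun x => inner ℝ h (g x)) ((innerSL ℝ h).comp (fderiv ℝ g x)) x :=
    (innerSL ℝ h).hasFDerivAt.comp x (hg.differentiableAt (hU.mem_nhds hx)).hasFDerivAt
  have h2 : HasFDerivAt F ((innerSL ℝ h).comp (fderiv ℝ g x)) x :=
    h1.congr_of_eventuallyEq (Filter.eventuallyEq_of_mem (hU.mem_nhds hx) hF)
  rw [partialDeriv, (h2.hasLineDerivAt _).lineDeriv]
  rfl

/-- One `g'` serves all `h`; this uniformity is what later produces a representer of the derivative.
Each partial derivative uses one order of regularity of `g`. -/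
lemma exists_iterate_partialDeriv {H : Type*} [NormedAddCommGroup H] [InnerProductSpace ℝ H]
    {U X : Set (EuclideanSpace ℝ (Fin d))} (hU : IsOpen U) (i : Fin d)
    (a : ℕ) {k : ℕ} {g : EuclideanSpace ℝ (Fin d) → H} (hg : CkUpTo (k + a) U X g)
    {F : H → EuclideanSpace ℝ (Fin d) → ℝ} (hF : ∀ h, ∀ x ∈ U, F h x = inner ℝ h (g x)) :
    ∃ g' : EuclideanSpace ℝ (Fin d) → H, CkUpTo k U X g' ∧
      ∀ h, ∀ x ∈ U, ((partialDeriv i)^[a] (F h)) x = inner ℝ h (g' x) := by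
  induction a generalizing k with
  | zero => exact ⟨g, hg, hF⟩
  | succ a ih =>
    obtain ⟨g', hg', hF'⟩ := ih (k := k + 1) (by rwa [add_right_comm, add_assoc])
    refine ⟨_, (hg'.ckUpTo_fderiv hU).clm_comp hU
      (ContinuousLinearMap.apply ℝ H (EuclideanSpace.single i (1 : ℝ))), fun h => ?_⟩
    rw [Function.iterate_succ_apply']
    exact partialDeriv_eq_inner hU hg'.differentiableOn h (hF' h) i

lemma exists_foldr_partialDeriv {H : Type*} [NormedAddCommGroup H] [InnerProductSpace ℝ H]
    {U X : Set (EuclideanSpace ℝ (Fin d))} (hU : IsOpen U)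
    (β : Fin d → ℕ) (l : List (Fin d)) {k : ℕ} {g : EuclideanSpace ℝ (Fin d) → H}
    (hg : CkUpTo (k + (l.map β).sum) U X g)
    {F : H → EuclideanSpace ℝ (Fin d) → ℝ} (hF : ∀ h, ∀ x ∈ U, F h x = inner ℝ h (g x)) :
    ∃ g' : EuclideanSpace ℝ (Fin d) → H, CkUpTo k U X g' ∧
      ∀ h, ∀ x ∈ U, l.foldr (fun i f => (partialDeriv i)^[β i] f) (F h) x = inner ℝ h (g' x) := by
  induction l generalizing k with
  | nil => exact ⟨g, by simpa using hg, hF⟩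
  | cons i l ih =>
    obtain ⟨g', hg', hF'⟩ := ih (k := k + β i) (by simpa [add_assoc] using hg)
    simpa only [List.foldr_cons] using exists_iterate_partialDeriv hU i (β i) hg' hF'

lemma sum_le_of_mem_multiIdx {β : Fin d → ℕ} (hβ : β ∈ multiIdx d s) : ∑ i, β i ≤ s :=
  (Finset.mem_filter.1 hβ).2

/-- The representer is the derivative of the feature map, extended continuously from the interior.
Pairing with `h` is continuous, so it commutes with the limit that defines `D`. -/
lemma exists_continuous_inner_eq_D (hX : X ⊆ closure (interior X))
    (hK : IsCk (2 * s) (kernProd (X := X) H)) {β : Fin d → ℕ} (hβ : β ∈ multiIdx d s) :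
    ∃ G : X → H, Continuous G ∧ ∀ (h : H) (x : X), D β (fun x => h x) x = inner ℝ h (G x) := by
  obtain ⟨g, hg, hgD⟩ := exists_foldr_partialDeriv (k := 0) isOpen_interior β (List.finRange d)
    ((ckUpTo_featExt hX hK).mono_order (by
      -- The orders used along the list add up to `|β| ≤ s`; none need be left over, hence `k = 0`.
      rw [zero_add, ← Fin.sum_univ_def]
      exact sum_le_of_mem_multiIdx hβ))
    (F := fun h => zeroExt (fun x : X => h x)) fun h x _ => zeroExt_eq_inner h x
  refine ⟨fun x => extendFrom (interior X) g x, ?_, fun h x => ?_⟩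
  · exact (continuousOn_extendFrom hX fun x hx => hg.exists_tendsto hx).domRestrict
  · have hlim := tendsto_extendFrom (hg.exists_tendsto x.2)
    have : (𝓝[interior X] (x : EuclideanSpace ℝ (Fin d))).NeBot :=
      mem_closure_iff_nhdsWithin_neBot.1 (hX x.2)
    refine Tendsto.limUnder_eq ((((innerSL ℝ h).continuous.tendsto _).comp hlim).congr' ?_)
    filter_upwards [self_mem_nhdsWithin] with y hy
    exact (hgD h y hy).symm

/-- `featDeriv` is a choice, so an element with the required values must be exhibited. The
representer works because `K(·, y)` itself lies in `H`, and its derivative is the pairing with the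
representer. -/
theorem featDeriv_apply (hX : X ⊆ closure (interior X))
    (hK : IsCk (2 * s) (kernProd (X := X) H)) {β : Fin d → ℕ} (hβ : β ∈ multiIdx d s)
    (x : X) (y : X) :
    featDeriv H β x y = D β (fun x' : X => kern H x' y) x := by
  obtain ⟨G, -, hG⟩ := exists_continuous_inner_eq_D hX hK hβ
  refine Classical.epsilon_spec (p := fun g : H => ∀ y : X, g y = D β (fun x' => kern H x' y) x)
    ⟨G x, fun y => ?_⟩ y
  simp only [kern_eq_apply]
  rw [hG, real_inner_comm, inner_kerFun_one]

/-- An element of `H` is determined by its values, so the chosen element is the representer. -/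
lemma featDeriv_eq (hX : X ⊆ closure (interior X))
    (hK : IsCk (2 * s) (kernProd (X := X) H)) {β : Fin d → ℕ} (hβ : β ∈ multiIdx d s)
    {G : X → H} (hG : ∀ (h : H) (x : X), D β (fun x => h x) x = inner ℝ h (G x)) :
    featDeriv H β = G := by
  ext x y
  rw [featDeriv_apply hX hK hβ]
  simp only [kern_eq_apply]
  rw [hG, real_inner_comm, inner_kerFun_one]

theorem D_eq_inner_featDeriv (hX : X ⊆ closure (interior X))
    (hK : IsCk (2 * s) (kernProd (X := X) H)) {β : Fin d → ℕ} (hβ : β ∈ multiIdx d s)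
    (h : H) (x : X) :
    D β (fun x' : X => h x') x = inner ℝ h (featDeriv H β x) := by
  obtain ⟨G, -, hG⟩ := exists_continuous_inner_eq_D hX hK hβ
  rw [hG, featDeriv_eq hX hK hβ hG]

theorem continuous_featDeriv (hX : X ⊆ closure (interior X))
    (hK : IsCk (2 * s) (kernProd (X := X) H)) {β : Fin d → ℕ} (hβ : β ∈ multiIdx d s) :
    Continuous (featDeriv H β : X → H) := by
  obtain ⟨G, hGc, hG⟩ := exists_continuous_inner_eq_D hX hK hβ
  rwa [featDeriv_eq hX hK hβ hG]

end Model

/-! ### The target functional as an inner product with `ψ`. -/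

section Target

variable {d s : ℕ} {X : Set (EuclideanSpace ℝ (Fin d))} {Y : Set ℝ} {H : Type*}
  [NormedAddCommGroup H] [InnerProductSpace ℝ H] [CompleteSpace H] [RKHS ℝ H X ℝ]
  {w : (Fin d → ℕ) → X × Y → ℝ}

theorem target_eq_inner (hX : X ⊆ closure (interior X)) (hK : IsCk (2 * s) (kernProd (X := X) H))
    (h : H) (z : X × Y) : target s w h z = inner ℝ h (psi H s w z) := by
  rw [target, psi, inner_sum]
  refine Finset.sum_congr rfl fun β hβ => ?_
  rw [D_eq_inner_featDeriv hX hK hβ, inner_smul_right]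

theorem stronglyMeasurable_psi (hX : X ⊆ closure (interior X))
    (hK : IsCk (2 * s) (kernProd (X := X) H)) (hw : ∀ β ∈ multiIdx d s, Measurable (w β)) :
    StronglyMeasurable (psi H s w : X × Y → H) := by
  refine Finset.stronglyMeasurable_fun_sum _ fun β hβ => ?_
  exact (hw β hβ).stronglyMeasurable.smul
    ((continuous_featDeriv hX hK hβ).stronglyMeasurable.comp_measurable measurable_fst)

end Target

/-! ### Regularized quadratic problems in a Hilbert space -/

section Quadratic

variable {H : Type*} [NormedAddCommGroup H] [InnerProductSpace ℝ H]

/-- A positive operator, in the form used for covariance operators. -/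
structure IsCovOp (S : H →L[ℝ] H) : Prop where
  symm : ∀ u v, (inner ℝ (S u) v : ℝ) = inner ℝ u (S v)
  nonneg : ∀ u, (0 : ℝ) ≤ inner ℝ u (S u)

variable {S : H →L[ℝ] H} {lam : ℝ}

lemma IsCovOp.le_inner (hS : IsCovOp S) (lam : ℝ) (u : H) :
    lam * ‖u‖ ^ 2 ≤ inner ℝ u ((S + lam • (1 : H →L[ℝ] H)) u) := by
  have := hS.nonneg u
  simp only [_root_.add_apply, _root_.smul_apply, one_apply_eq_self,
    inner_add_right, inner_smul_right, real_inner_self_eq_norm_sq]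
  linarith

lemma IsCovOp.symm_reg (hS : IsCovOp S) (lam : ℝ) (u v : H) :
    (inner ℝ ((S + lam • (1 : H →L[ℝ] H)) u) v : ℝ)
      = inner ℝ u ((S + lam • (1 : H →L[ℝ] H)) v) := by
  simp [inner_add_left, inner_add_right, inner_smul_left, inner_smul_right, hS.symm]

/-- The constant `λ⁻¹` does not depend on `S`, so the bound holds for every random sample covariance
alike. -/
lemma IsCovOp.norm_le (hS : IsCovOp S) (hlam : 0 < lam) (u : H) :
    ‖u‖ ≤ lam⁻¹ * ‖(S + lam • (1 : H →L[ℝ] H)) u‖ := by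
  rcases eq_or_ne u 0 with rfl | hu
  · simp
  have h0 : 0 < ‖u‖ := norm_pos_iff.2 hu
  have h1 := (hS.le_inner lam u).trans (real_inner_le_norm _ _)
  rw [← div_eq_inv_mul, le_div_iff₀ hlam]
  nlinarith

lemma IsCovOp.isUnit [CompleteSpace H] (hS : IsCovOp S) (hlam : 0 < lam) :
    IsUnit (S + lam • (1 : H →L[ℝ] H)) := by
  refine ContinuousLinearMap.isUnit_of_forall_le_norm_inner_map _ (c := ⟨lam, hlam.le⟩) hlam
    fun u => ?_
  rw [real_inner_comm, mul_comm]
  exact (hS.le_inner lam u).trans (le_abs_self _)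

/-- The solution of `(S + λ) h = m`. -/
noncomputable def regSol (S : H →L[ℝ] H) (lam : ℝ) (m : H) : H :=
  Ring.inverse (S + lam • (1 : H →L[ℝ] H)) m

lemma IsCovOp.apply_regSol [CompleteSpace H] (hS : IsCovOp S) (hlam : 0 < lam) (m : H) :
    (S + lam • (1 : H →L[ℝ] H)) (regSol S lam m) = m := by
  rw [regSol, ← mul_apply_eq_comp, Ring.mul_inverse_cancel _ (hS.isUnit hlam)]
  rfl

/-- The quadratic functional minimized by `regSol`. -/
noncomputable def quadObj (S : H →L[ℝ] H) (lam : ℝ) (m : H) (h : H) : ℝ :=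
  -inner ℝ h m + 1 / 2 * inner ℝ h (S h) + lam / 2 * ‖h‖ ^ 2

/-- Completing the square; existence and uniqueness of the minimizer both follow from coercivity of
the last term. -/
lemma IsCovOp.quadObj_eq [CompleteSpace H] (hS : IsCovOp S) (hlam : 0 < lam) (m h : H) :
    quadObj S lam m h = quadObj S lam m (regSol S lam m) + 1 / 2 *
      inner ℝ (h - regSol S lam m) ((S + lam • (1 : H →L[ℝ] H)) (h - regSol S lam m)) := by
  have hr := hS.apply_regSol hlam m
  set r := regSol S lam m
  rw [quadObj, quadObj, ← real_inner_self_eq_norm_sq, ← real_inner_self_eq_norm_sq, ← hr]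
  have h1 : (inner ℝ r (S h) : ℝ) = inner ℝ h (S r) := by rw [← hS.symm, real_inner_comm]
  have h2 : (inner ℝ r h : ℝ) = inner ℝ h r := real_inner_comm _ _
  simp only [map_sub, _root_.add_apply, _root_.smul_apply, one_apply_eq_self,
    inner_add_right, inner_smul_right, inner_sub_left, inner_sub_right, h1, h2]
  ring

lemma IsCovOp.quadObj_regSol_le [CompleteSpace H] (hS : IsCovOp S) (hlam : 0 < lam) (m h : H) :
    quadObj S lam m (regSol S lam m) ≤ quadObj S lam m h := by
  rw [hS.quadObj_eq hlam m h]
  have := hS.le_inner lam (h - regSol S lam m)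
  have := mul_nonneg hlam.le (sq_nonneg ‖h - regSol S lam m‖)
  linarith

lemma IsCovOp.eq_regSol [CompleteSpace H] (hS : IsCovOp S) (hlam : 0 < lam) {m h : H}
    (hh : ∀ g, quadObj S lam m h ≤ quadObj S lam m g) : h = regSol S lam m := by
  have h1 := hh (regSol S lam m)
  rw [hS.quadObj_eq hlam m h] at h1
  have h2 := hS.le_inner lam (h - regSol S lam m)
  have h3 : ‖h - regSol S lam m‖ ^ 2 ≤ 0 := by
    by_contra! h4
    nlinarith
  rw [← sub_eq_zero, ← norm_eq_zero]
  exact pow_eq_zero_iff two_ne_zero |>.1 (le_antisymm h3 (sq_nonneg _))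

lemma IsCovOp.existsUnique_min [CompleteSpace H] (hS : IsCovOp S) (hlam : 0 < lam) {m : H}
    {J : H → ℝ} (hJ : ∀ h, J h = quadObj S lam m h) : ∃! h : H, ∀ g : H, J h ≤ J g := by
  simp only [hJ]
  exact ⟨regSol S lam m, hS.quadObj_regSol_le hlam m, fun h hh => hS.eq_regSol hlam hh⟩

lemma IsCovOp.argmin_eq [CompleteSpace H] (hS : IsCovOp S) (hlam : 0 < lam) {m : H}
    {J : H → ℝ} (hJ : ∀ h, J h = quadObj S lam m h) : argmin J = regSol S lam m := by
  refine hS.eq_regSol hlam fun g => ?_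
  have := Classical.epsilon_spec (p := fun h => ∀ g, J h ≤ J g)
    (hS.existsUnique_min hlam hJ).exists g
  rwa [hJ, hJ] at this

end Quadratic

/-! ### Empirical mean and covariance in a Hilbert space -/

section Sample

variable {H : Type*} [NormedAddCommGroup H] [InnerProductSpace ℝ H]

/-- The mean of `x 0, …, x (N - 1)`. -/
noncomputable def avg {H : Type*} [AddCommGroup H] [Module ℝ H] (N : ℕ) (x : ℕ → H) : H :=
  (N : ℝ)⁻¹ • ∑ i ∈ Finset.range N, x i

/-- The covariance operator of `x 0, …, x (N - 1)`. -/
noncomputable def sampleCov (N : ℕ) (x : ℕ → H) : H →L[ℝ] H :=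
  avg N fun i => rankOne ℝ (x i - avg N x) (x i - avg N x)

lemma inner_avg (N : ℕ) (x : ℕ → H) (h : H) :
    (inner ℝ h (avg N x) : ℝ) = sampleMean N fun i => inner ℝ h (x i) := by
  rw [avg, inner_smul_right, inner_sum, sampleMean]

lemma sampleCov_apply (N : ℕ) (x : ℕ → H) (u : H) :
    sampleCov N x u = avg N fun i => (inner ℝ (x i - avg N x) u : ℝ) • (x i - avg N x) := by
  simp only [sampleCov, avg.eq_1 (H := H →L[ℝ] H), _root_.smul_apply, _root_.sum_apply, rankOne_apply]
  rfl

lemma inner_sampleCov (N : ℕ) (x : ℕ → H) (u v : H) :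
    (inner ℝ v (sampleCov N x u) : ℝ)
      = sampleMean N fun i => inner ℝ v (x i - avg N x) * inner ℝ u (x i - avg N x) := by
  rw [sampleCov_apply, inner_avg]
  congr 1
  ext i
  rw [inner_smul_right, real_inner_comm, mul_comm]

lemma isCovOp_sampleCov (N : ℕ) (x : ℕ → H) : IsCovOp (sampleCov N x) where
  symm u v := by
    rw [real_inner_comm, inner_sampleCov, inner_sampleCov]
    simp only [mul_comm]
  nonneg u := by
    rw [inner_sampleCov]
    exact mul_nonneg (by positivity) (Finset.sum_nonneg fun i _ => mul_self_nonneg _)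

lemma sampleVar_inner (N : ℕ) (x : ℕ → H) (h : H) :
    sampleVar N (fun i => inner ℝ h (x i)) = inner ℝ h (sampleCov N x h) := by
  rw [inner_sampleCov, sampleVar, ← inner_avg]
  congr 1
  ext i
  rw [inner_sub_right, sq]

lemma avg_sub_const {N : ℕ} (hN : N ≠ 0) (x : ℕ → H) (m : H) :
    avg N (fun i => x i - m) = avg N x - m := by
  have : (N : ℝ) ≠ 0 := by exact_mod_cast hN
  rw [avg, Finset.sum_sub_distrib, smul_sub, avg]
  simp [← Nat.cast_smul_eq_nsmul ℝ, smul_smul, this]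

lemma avg_sub (N : ℕ) (x y : ℕ → H) : avg N (fun i => x i - y i) = avg N x - avg N y := by
  rw [avg, Finset.sum_sub_distrib, smul_sub, avg, avg]

lemma avg_clm {H' : Type*} [NormedAddCommGroup H'] [InnerProductSpace ℝ H'] (N : ℕ) (x : ℕ → H)
    (T : H →L[ℝ] H') : avg N (fun i => T (x i)) = T (avg N x) := by
  simp [avg]

/-- Centering at another point `m` changes the sample covariance by a rank one operator. -/
lemma sampleCov_apply_eq {N : ℕ} (hN : N ≠ 0) (x : ℕ → H) (m u : H) :
    sampleCov N x u = avg N (fun i => (inner ℝ (x i - m) u : ℝ) • (x i - m))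
      - (inner ℝ (avg N x - m) u : ℝ) • (avg N x - m) := by
  set δ := avg N x - m with hδ
  have h0 : avg N (fun i => x i - m) = δ := avg_sub_const hN x m
  have h1 : ∀ i, (inner ℝ (x i - avg N x) u : ℝ) • (x i - avg N x)
      = ((inner ℝ (x i - m) u : ℝ) • (x i - m) - (inner ℝ δ u : ℝ) • ((x i - m) - δ))
        - (rankOne ℝ δ u) (x i - m) := by
    intro i
    have : x i - avg N x = (x i - m) - δ := by rw [hδ]; abel
    rw [this, inner_sub_left, rankOne_apply, real_inner_comm (x i - m) u]
    module
  have h2 : ∀ i, (inner ℝ δ u : ℝ) • ((x i - m) - δ)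
      = ((inner ℝ δ u : ℝ) • ContinuousLinearMap.id ℝ H) ((x i - m) - δ) := fun i => by simp
  rw [sampleCov_apply]
  simp only [h1, h2]
  rw [avg_sub, avg_sub, avg_clm, avg_clm, avg_sub_const hN (fun i => x i - m), h0]
  simp [real_inner_comm]

variable {S : H →L[ℝ] H} {lam : ℝ}

/-- The influence function of the regularized solution. -/
noncomputable def infl (S : H →L[ℝ] H) (m h x : H) : H :=
  (x - m) - ((inner ℝ (x - m) h : ℝ) • (x - m) - S h)

/-- Write `h` for the population solution. Replacing `λ h` by `m - S h` turns the left side into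
`(avg - m) - (sampleCov h - S h)`. Recentering the sample covariance at `m` leaves the average of
the influence function and one rank-one correction. -/
lemma reg_apply_sub [CompleteSpace H] (hS : IsCovOp S) (hlam : 0 < lam) (m : H) {N : ℕ} (hN : N ≠ 0)
    (x : ℕ → H) :
    (sampleCov N x + lam • (1 : H →L[ℝ] H))
        (regSol (sampleCov N x) lam (avg N x) - regSol S lam m)
      = avg N (fun i => infl S m (regSol S lam m) (x i))
        + (inner ℝ (avg N x - m) (regSol S lam m) : ℝ) • (avg N x - m) := by
  have h1 := hS.apply_regSol hlam m
  rw [map_sub, (isCovOp_sampleCov N x).apply_regSol hlam]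
  set h := regSol S lam m
  have h2 : avg N (fun i => infl S m h (x i)) = (avg N x - m)
      - (avg N (fun i => (inner ℝ (x i - m) h : ℝ) • (x i - m)) - S h) := by
    simp only [infl]
    rw [avg_sub, avg_sub_const hN, avg_sub_const hN]
  rw [h2, _root_.add_apply, sampleCov_apply_eq hN x m]
  simp only [_root_.add_apply, _root_.smul_apply, one_apply_eq_self] at h1 ⊢
  rw [eq_sub_of_add_eq' h1]
  abel

/-- First order expansion of the empirical solution around the population solution. -/
lemma inner_regSol_sub [CompleteSpace H] (hS : IsCovOp S) (hlam : 0 < lam) (m φ : H) {N : ℕ}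
    (hN : N ≠ 0) (x : ℕ → H) :
    (inner ℝ (regSol (sampleCov N x) lam (avg N x) - regSol S lam m) φ : ℝ)
      = inner ℝ (avg N (fun i => infl S m (regSol S lam m) (x i))) (regSol S lam φ)
      + (inner ℝ (avg N x - m) (regSol S lam m) * inner ℝ (avg N x - m) (regSol S lam φ)
      - inner ℝ (regSol (sampleCov N x) lam (avg N x) - regSol S lam m)
        (sampleCov N x (regSol S lam φ) - S (regSol S lam φ))) := by
  have h1 := reg_apply_sub hS hlam m hN x
  have h2 := hS.apply_regSol hlam φ
  set u := regSol S lam φ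
  set D := regSol (sampleCov N x) lam (avg N x) - regSol S lam m
  -- Symmetry moves the empirical operator onto `u`; comparison with `φ = (S + λ) u` leaves the
  -- error `sampleCov u - S u`.
  have h3 := congrArg (fun v => (inner ℝ v u : ℝ)) h1
  simp only [(isCovOp_sampleCov N x).symm_reg, inner_add_left, inner_smul_left] at h3
  nth_rw 1 [← h2]
  simp only [_root_.add_apply, _root_.smul_apply, one_apply_eq_self, inner_add_right,
    inner_sub_right, conj_trivial] at h3 ⊢
  linarith

/-- The bound is shaped for `tendstoInMeasure_of_le_mul`: the first factor will be bounded in `L¹`,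
the second will tend to zero. -/
lemma norm_remainder_le [CompleteSpace H] (hS : IsCovOp S) (hlam : 0 < lam) (m φ : H) {N : ℕ}
    (hN : N ≠ 0) (x : ℕ → H) :
    √(N : ℝ) * |inner ℝ (regSol (sampleCov N x) lam (avg N x) - regSol S lam m) φ
      - inner ℝ (avg N (fun i => infl S m (regSol S lam m) (x i))) (regSol S lam φ)|
    ≤ (1 + N * ‖avg N x - m‖ ^ 2
        + N * ‖avg N (fun i => infl S m (regSol S lam m) (x i))‖ ^ 2)
      * (‖avg N x - m‖ * (‖regSol S lam m‖ * ‖regSol S lam φ‖)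
        + lam⁻¹ * (1 + ‖avg N x - m‖ * ‖regSol S lam m‖)
          * ‖sampleCov N x (regSol S lam φ) - S (regSol S lam φ)‖) := by
  have h1 := (isCovOp_sampleCov N x).norm_le hlam
    (regSol (sampleCov N x) lam (avg N x) - regSol S lam m)
  rw [reg_apply_sub hS hlam m hN x] at h1
  rw [inner_regSol_sub hS hlam m φ hN x, add_sub_cancel_left]
  set u := regSol S lam φ
  set h := regSol S lam m
  set D := regSol (sampleCov N x) lam (avg N x) - h
  set δ := avg N x - m
  set a := avg N (fun i => infl S m h (x i))
  set e := sampleCov N x u - S u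
  have h2 : ‖D‖ ≤ lam⁻¹ * (‖a‖ + ‖δ‖ * ‖h‖ * ‖δ‖) := by
    refine h1.trans ?_
    gcongr
    refine (norm_add_le _ _).trans ?_
    gcongr
    rw [norm_smul]
    gcongr
    exact norm_inner_le_norm _ _
  have h3 : |inner ℝ δ h * inner ℝ δ u - inner ℝ D e| ≤ ‖δ‖ * ‖h‖ * (‖δ‖ * ‖u‖) + ‖D‖ * ‖e‖ := by
    refine (abs_sub _ _).trans ?_
    rw [abs_mul]
    gcongr <;> exact abs_real_inner_le_norm _ _
  have hs : √(N : ℝ) ^ 2 = N := Real.sq_sqrt (by positivity)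
  set q := √(N : ℝ)
  have hq : 0 ≤ q := Real.sqrt_nonneg _
  -- From `a ≤ 1 + a²`: first powers are traded for second moments, which are computable exactly.
  have A : q * ‖δ‖ ≤ 1 + N * ‖δ‖ ^ 2 + N * ‖a‖ ^ 2 := by
    rw [← hs]; nlinarith [sq_nonneg (q * ‖δ‖ - 1), sq_nonneg (q * ‖a‖), sq_nonneg (q * ‖δ‖)]
  have B : q * ‖a‖ ≤ 1 + N * ‖δ‖ ^ 2 + N * ‖a‖ ^ 2 := by
    rw [← hs]; nlinarith [sq_nonneg (q * ‖a‖ - 1), sq_nonneg (q * ‖a‖), sq_nonneg (q * ‖δ‖)]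
  set M := 1 + N * ‖δ‖ ^ 2 + N * ‖a‖ ^ 2
  calc q * |inner ℝ δ h * inner ℝ δ u - inner ℝ D e|
      ≤ q * (‖δ‖ * ‖h‖ * (‖δ‖ * ‖u‖) + (lam⁻¹ * (‖a‖ + ‖δ‖ * ‖h‖ * ‖δ‖)) * ‖e‖) := by
        gcongr
        exact h3.trans (by gcongr)
    _ = (q * ‖δ‖) * (‖δ‖ * (‖h‖ * ‖u‖)) + lam⁻¹ * ((q * ‖a‖) + (q * ‖δ‖) * (‖δ‖ * ‖h‖)) * ‖e‖ := by
        ring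
    _ ≤ M * (‖δ‖ * (‖h‖ * ‖u‖)) + lam⁻¹ * (M + M * (‖δ‖ * ‖h‖)) * ‖e‖ := by gcongr
    _ = M * (‖δ‖ * (‖h‖ * ‖u‖) + lam⁻¹ * (1 + ‖δ‖ * ‖h‖) * ‖e‖) := by ring

end Sample

/-! ### Convergence in probability and in distribution -/

section Convergence

variable {Ω : Type*} [MeasurableSpace Ω] {μ : Measure Ω} [IsProbabilityMeasure μ]

/-- A product of a sequence bounded in `L¹` and a sequence converging to zero in probability
converges to zero in probability. -/
lemma tendstoInMeasure_of_le_mul {A B R : ℕ → Ω → ℝ} {C : ℝ} (hA0 : ∀ N ω, 0 ≤ A N ω)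
    (hAi : ∀ N, Integrable (A N) μ) (hAC : ∀ᶠ N in atTop, ∫ ω, A N ω ∂μ ≤ C)
    (hB0 : ∀ N ω, 0 ≤ B N ω) (hB : TendstoInMeasure μ B atTop 0)
    (hR : ∀ᶠ N in atTop, ∀ ω, |R N ω| ≤ A N ω * B N ω) : TendstoInMeasure μ R atTop 0 := by
  rw [tendstoInMeasure_iff_measureReal_norm] at hB ⊢
  intro ε hε
  simp only [Pi.zero_apply, sub_zero] at hB ⊢
  rw [Metric.tendsto_nhds]
  intro η hη
  have hC : 0 ≤ C := by
    obtain ⟨N, hN⟩ := hAC.exists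
    exact (integral_nonneg (hA0 N)).trans hN
  obtain ⟨M, hM, hMη⟩ : ∃ M > 0, C / M < η / 2 :=
    ⟨2 * (C + 1) / η, by positivity, by
      rw [div_div_eq_mul_div, div_lt_iff₀ (by positivity)]; nlinarith⟩
  filter_upwards [hAC, hR, (hB (ε / M) (by positivity)).eventually (gt_mem_nhds (half_pos hη))]
    with N h1 h2 h3
  -- If both factors were small, the product would be below `M · (ε / M) = ε`. Markov's inequality
  -- controls the first set, and convergence of `B` the second.
  have hsub : {ω | ε ≤ ‖R N ω‖} ⊆ {ω | M ≤ A N ω} ∪ {ω | ε / M ≤ ‖B N ω‖} := by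
    intro ω hω
    by_contra hcon
    simp only [Set.mem_union, Set.mem_ofPred_eq, not_or, not_le, Real.norm_eq_abs] at hcon hω
    rw [abs_of_nonneg (hB0 N ω)] at hcon
    have : A N ω * B N ω ≤ M * B N ω := by
      have := hB0 N ω
      gcongr
      exact hcon.1.le
    have h4 : M * B N ω < ε := by rw [mul_comm, ← lt_div_iff₀ hM]; exact hcon.2
    linarith [h2 ω]
  have h5 : μ.real {ω | M ≤ A N ω} ≤ C / M := by
    rw [le_div_iff₀ hM, mul_comm]
    exact (mul_meas_ge_le_integral_of_nonneg (ae_of_all _ (hA0 N)) (hAi N) M).trans h1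
  have h6 := (measureReal_mono hsub (measure_ne_top _ _)).trans (measureReal_union_le (μ := μ) _ _)
  rw [Real.dist_eq, sub_zero, abs_of_nonneg measureReal_nonneg]
  linarith

/-- The Cramér-Wold device for Gaussian limits. -/
lemma tendstoInDistribution_multivariateGaussian {n : ℕ} {W : ℕ → Ω → EuclideanSpace ℝ (Fin n)}
    (hW : ∀ N, AEMeasurable (W N) μ) {C : Matrix (Fin n) (Fin n) ℝ} (hC : C.PosSemidef)
    (h : ∀ t : EuclideanSpace ℝ (Fin n), ∃ v : NNReal, (v : ℝ) = t.ofLp ⬝ᵥ C.mulVec t.ofLp ∧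
      TendstoInDistribution (fun N ω => (inner ℝ (W N ω) t : ℝ)) atTop id (fun _ => μ)
        (gaussianReal 0 v)) :
    TendstoInDistribution W atTop (id : EuclideanSpace ℝ (Fin n) → EuclideanSpace ℝ (Fin n))
      (fun _ => μ) (multivariateGaussian 0 C) where
  forall_aemeasurable := hW
  aemeasurable_limit := aemeasurable_id
  tendsto := by
    refine ProbabilityMeasure.tendsto_iff_tendsto_charFun.2 fun t => ?_
    obtain ⟨v, hv, hd⟩ := h t
    -- The characteristic function of `W` at `t` is that of the scalar `⟪W, t⟫` at `1`.
    have h1 := ProbabilityMeasure.tendsto_iff_tendsto_charFun.1 hd.tendsto 1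
    simp only [ProbabilityMeasure.coe_mk, Measure.map_id] at h1 ⊢
    rw [charFun_gaussianReal] at h1
    rw [charFun_multivariateGaussian hC, ← hv]
    convert h1 using 2 with N
    · rw [charFun_apply, charFun_apply, integral_map (hW N) (by fun_prop),
        integral_map (hd.forall_aemeasurable N) (by fun_prop)]
      simp
    · simp

end Convergence

/-! ### Integrability, measurability and second moments of averages in a Hilbert space. -/

section Moments

variable {Ω : Type*} [MeasurableSpace Ω] {μ : Measure Ω} {H : Type*} [NormedAddCommGroup H]
  [InnerProductSpace ℝ H]

lemma integrable_inner_of_memLp {f g : Ω → H} (hf : MemLp f 2 μ) (hg : MemLp g 2 μ) :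
    Integrable (fun ω => (inner ℝ (f ω) (g ω) : ℝ)) μ := by
  refine (hf.norm.integrable_mul hg.norm).mono (hf.1.inner hg.1) (ae_of_all _ fun ω => ?_)
  simpa using norm_inner_le_norm (𝕜 := ℝ) (f ω) (g ω)

lemma memLp_avg {G : ℕ → Ω → H} {p : ENNReal} (hG : ∀ i, MemLp (G i) p μ) (N : ℕ) :
    MemLp (fun ω => avg N fun i => G i ω) p μ :=
  (memLp_finsetSum _ fun i _ => hG i).const_smul _

/-- Composition with a map that is continuous at almost all values preserves strong
measurability. -/
lemma aestronglyMeasurable_comp_of_continuousAt {A B : Type*} [TopologicalSpace A]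
    [TopologicalSpace B] [TopologicalSpace.PseudoMetrizableSpace B] {f : Ω → A} {g : A → B}
    (hf : AEStronglyMeasurable f μ) (hg : ∀ ω, ContinuousAt g (f ω)) :
    AEStronglyMeasurable (fun ω => g (f ω)) μ := by
  refine aestronglyMeasurable_of_tendsto_ae atTop
    (f := fun n ω => g (hf.stronglyMeasurable_mk.approx n ω))
    (fun n => ((hf.stronglyMeasurable_mk.approx n).map g).aestronglyMeasurable) ?_
  filter_upwards [hf.ae_eq_mk] with ω hω
  have h := hf.stronglyMeasurable_mk.tendsto_approx ω
  rw [← hω] at h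
  exact (hg ω).tendsto.comp h

/-- The fourth moment enters here: the squared norm is at most `‖u‖² ‖W‖⁴`. -/
lemma memLp_inner_smul_self {W : Ω → H} (hW : MemLp W 4 μ) (u : H) :
    MemLp (fun ω => (inner ℝ (W ω) u : ℝ) • W ω) 2 μ := by
  have hm : AEStronglyMeasurable (fun ω => (inner ℝ (W ω) u : ℝ) • W ω) μ :=
    (hW.1.inner aestronglyMeasurable_const).smul hW.1
  refine (memLp_two_iff_integrable_sq_norm hm).2 ?_
  have h4 : Integrable (fun ω => ‖W ω‖ ^ 4) μ := hW.integrable_norm_pow (by norm_num)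
  refine (h4.const_mul (‖u‖ ^ 2)).mono' (hm.norm.pow 2) (ae_of_all _ fun ω => ?_)
  rw [norm_pow, norm_norm, norm_smul, mul_pow]
  have := norm_inner_le_norm (𝕜 := ℝ) (W ω) u
  calc ‖(inner ℝ (W ω) u : ℝ)‖ ^ 2 * ‖W ω‖ ^ 2 ≤ (‖W ω‖ * ‖u‖) ^ 2 * ‖W ω‖ ^ 2 := by gcongr
    _ = ‖u‖ ^ 2 * ‖W ω‖ ^ 4 := by ring

lemma aestronglyMeasurable_avg {F : Type*} [NormedAddCommGroup F] [NormedSpace ℝ F]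
    {G : ℕ → Ω → F} (hG : ∀ i, AEStronglyMeasurable (G i) μ) (N : ℕ) :
    AEStronglyMeasurable (fun ω => avg N fun i => G i ω) μ :=
  (Finset.aestronglyMeasurable_fun_sum _ fun i _ => hG i).const_smul _

lemma aestronglyMeasurable_sampleCov {V : ℕ → Ω → H} (hV : ∀ i, AEStronglyMeasurable (V i) μ)
    (N : ℕ) : AEStronglyMeasurable (fun ω => sampleCov N fun i => V i ω) μ := by
  have hc : Continuous fun x : H => (rankOne ℝ x x : H →L[ℝ] H) := by
    have : ∀ x : H, (rankOne ℝ x x : H →L[ℝ] H)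
        = ContinuousLinearMap.smulRightL ℝ H H (innerSL ℝ x) x := fun x => by ext; simp
    simp only [this]
    fun_prop
  exact aestronglyMeasurable_avg
    (fun i => hc.comp_aestronglyMeasurable ((hV i).sub (aestronglyMeasurable_avg hV N))) N

/-- Inversion is continuous only at units, but the regularized sample covariance is a unit for every
`ω`. -/
lemma aestronglyMeasurable_regSol [CompleteSpace H] {V : ℕ → Ω → H}
    (hV : ∀ i, AEStronglyMeasurable (V i) μ) {lam : ℝ} (hlam : 0 < lam) (N : ℕ) :
    AEStronglyMeasurable
      (fun ω => regSol (sampleCov N fun i => V i ω) lam (avg N fun i => V i ω)) μ := by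
  have h1 : AEStronglyMeasurable (fun ω => Ring.inverse
      ((sampleCov N fun i => V i ω) + lam • (1 : H →L[ℝ] H))) μ := by
    refine aestronglyMeasurable_comp_of_continuousAt (g := Ring.inverse)
      ((aestronglyMeasurable_sampleCov hV N).add aestronglyMeasurable_const) fun ω => ?_
    obtain ⟨x, hx⟩ := (isCovOp_sampleCov N fun i => V i ω).isUnit hlam
    rw [← hx]
    exact NormedRing.inverse_continuousAt x
  exact (isBoundedBilinearMap_apply (𝕜 := ℝ) (E := H) (F := H)).continuous.comp_aestronglyMeasurable
    (h1.prodMk (aestronglyMeasurable_avg hV N))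

variable [IsProbabilityMeasure μ] [CompleteSpace H] [MeasurableSpace H] [BorelSpace H]

/-- Cross terms vanish by pairwise independence and centering. -/
lemma integral_norm_sum_sq {G : ℕ → Ω → H} (hG : ∀ i, MemLp (G i) 2 μ)
    (hind : Pairwise fun i j => IndepFun (G i) (G j) μ)
    (h0 : ∀ i, ∫ ω, G i ω ∂μ = 0) {c : ℝ} (hc : ∀ i, ∫ ω, ‖G i ω‖ ^ 2 ∂μ = c) (N : ℕ) :
    ∫ ω, ‖∑ i ∈ Finset.range N, G i ω‖ ^ 2 ∂μ = N * c := by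
  induction N with
  | zero => simp
  | succ N ih =>
    have hS : MemLp (fun ω => ∑ i ∈ Finset.range N, G i ω) 2 μ :=
      memLp_finsetSum _ fun i _ => hG i
    have h1 : ∫ ω, (inner ℝ (∑ i ∈ Finset.range N, G i ω) (G N ω) : ℝ) ∂μ = 0 := by
      simp only [sum_inner]
      rw [integral_finsetSum _ fun i _ => integrable_inner_of_memLp (hG i) (hG N)]
      refine Finset.sum_eq_zero fun i hi => ?_
      have := (hind (Finset.mem_range.1 hi).ne).integral_bilin
        ((hG i).integrable (by norm_num)) ((hG N).integrable (by norm_num)) (innerSL ℝ)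
      rw [h0, h0, map_zero] at this
      exact this
    simp only [Finset.sum_range_succ, norm_add_sq_real]
    have i1 : Integrable (fun ω => ‖∑ i ∈ Finset.range N, G i ω‖ ^ 2) μ :=
      hS.integrable_norm_pow (by norm_num)
    have i2 := (integrable_inner_of_memLp hS (hG N)).const_mul 2
    have i3 : Integrable (fun ω => ‖G N ω‖ ^ 2) μ := (hG N).integrable_norm_pow (by norm_num)
    have i12 := integral_add (i1.add i2) i3
    simp only [Pi.add_apply] at i12
    rw [i12, integral_add i1 i2, integral_const_mul, h1, ih, hc]
    push_cast
    ring

lemma integral_norm_avg_sq {G : ℕ → Ω → H} (hG : ∀ i, MemLp (G i) 2 μ)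
    (hind : Pairwise fun i j => IndepFun (G i) (G j) μ)
    (h0 : ∀ i, ∫ ω, G i ω ∂μ = 0) {c : ℝ} (hc : ∀ i, ∫ ω, ‖G i ω‖ ^ 2 ∂μ = c) {N : ℕ}
    (hN : N ≠ 0) : ∫ ω, N * ‖avg N fun i => G i ω‖ ^ 2 ∂μ = c := by
  have hN' : (N : ℝ) ≠ 0 := by exact_mod_cast hN
  have : ∀ ω, (N : ℝ) * ‖avg N fun i => G i ω‖ ^ 2
      = (N : ℝ)⁻¹ * ‖∑ i ∈ Finset.range N, G i ω‖ ^ 2 := fun ω => by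
    rw [avg, norm_smul, mul_pow, norm_inv, Real.norm_natCast]
    field_simp
  simp only [this]
  rw [integral_const_mul, integral_norm_sum_sq hG hind h0 hc]
  field_simp

end Moments

/-! ### Asymptotic normality of regularized solutions -/

section Asymptotics

lemma continuous_infl {H : Type*} [NormedAddCommGroup H] [InnerProductSpace ℝ H] (S : H →L[ℝ] H)
    (m h : H) : Continuous (infl S m h) := by
  unfold infl
  fun_prop

section

variable {Ω : Type*} [MeasurableSpace Ω] {μ : Measure Ω} [IsProbabilityMeasure μ] {H : Type*}
  [NormedAddCommGroup H] [InnerProductSpace ℝ H] {W : Ω → H}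

lemma memLp_infl (hW : MemLp W 4 μ) (S : H →L[ℝ] H) (m h : H) :
    MemLp (fun ω => infl S m h (W ω)) 2 μ := by
  have h4 : MemLp (fun ω => W ω - m) 4 μ := hW.sub (memLp_const m)
  exact (h4.mono_exponent (by norm_num)).sub ((memLp_inner_smul_self h4 h).sub (memLp_const _))

lemma integral_infl [CompleteSpace H] {S : H →L[ℝ] H} {m : H} (hW : MemLp W 4 μ)
    (hm : ∫ ω, W ω ∂μ = m)
    (hS : ∀ u, ∫ ω, (inner ℝ (W ω - m) u : ℝ) • (W ω - m) ∂μ = S u) (h : H) :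
    ∫ ω, infl S m h (W ω) ∂μ = 0 := by
  have h4 : MemLp (fun ω => W ω - m) 4 μ := hW.sub (memLp_const m)
  have i0 : Integrable W μ := hW.integrable (by norm_num)
  have i1 : Integrable (fun ω => W ω - m) μ := h4.integrable (by norm_num)
  have i2 := (memLp_inner_smul_self h4 h).integrable (by norm_num)
  have i3 : Integrable (fun ω => (inner ℝ (W ω - m) h : ℝ) • (W ω - m) - S h) μ :=
    i2.sub (integrable_const _)
  simp only [infl]
  rw [integral_sub i1 i3, integral_sub i2 (integrable_const _), hS,
    integral_sub i0 (integrable_const _), hm]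
  simp

end

variable {Ω : Type*} [MeasurableSpace Ω] {μ : Measure Ω}
  {H : Type*} [NormedAddCommGroup H] [InnerProductSpace ℝ H] [CompleteSpace H]
  [MeasurableSpace H] [BorelSpace H] {V : ℕ → Ω → H}

lemma tendsto_avg_comp (hid : ∀ i, IdentDistrib (V i) (V 0) μ μ) (hind : iIndepFun V μ) {g : H → H}
    (hg : Continuous g) (hint : Integrable (fun ω => g (V 0 ω)) μ) :
    ∀ᵐ ω ∂μ, Tendsto (fun N => avg N fun i => g (V i ω)) atTop (𝓝 (∫ ω, g (V 0 ω) ∂μ)) :=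
  strong_law_ae (fun i ω => g (V i ω)) hint
    (fun _ _ hij => (hind.indepFun hij).comp hg.measurable hg.measurable)
    fun i => (hid i).comp hg.measurable

variable [IsProbabilityMeasure μ]

lemma integral_norm_avg_comp_sq (hid : ∀ i, IdentDistrib (V i) (V 0) μ μ) (hind : iIndepFun V μ)
    {g : H → H} (hg : Continuous g) (hLp : MemLp (fun ω => g (V 0 ω)) 2 μ)
    (h0 : ∫ ω, g (V 0 ω) ∂μ = 0) {N : ℕ} (hN : N ≠ 0) :
    ∫ ω, N * ‖avg N fun i => g (V i ω)‖ ^ 2 ∂μ = ∫ ω, ‖g (V 0 ω)‖ ^ 2 ∂μ := by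
  have hid' : ∀ i, IdentDistrib (fun ω => g (V i ω)) (fun ω => g (V 0 ω)) μ μ :=
    fun i => (hid i).comp hg.measurable
  refine integral_norm_avg_sq (G := fun i ω => g (V i ω)) (fun i => (hid' i).memLp_iff.2 hLp)
    (fun _ _ hij => (hind.indepFun hij).comp hg.measurable hg.measurable)
    (fun i => (hid' i).integral_eq.trans h0) (fun i => ?_) hN
  exact ((hid' i).comp (u := fun v : H => ‖v‖ ^ 2)
    (by fun_prop : Continuous fun v : H => ‖v‖ ^ 2).measurable).integral_eq

variable {S : H →L[ℝ] H} {m : H} {lam : ℝ}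

/-- The central limit theorem for the linear part of the expansion. -/
lemma tendstoInDistribution_inner_avg_infl (hid : ∀ i, IdentDistrib (V i) (V 0) μ μ)
    (hind : iIndepFun V μ) (hV : MemLp (V 0) 4 μ) (hm : ∫ ω, V 0 ω ∂μ = m)
    (hS : ∀ u, ∫ ω, (inner ℝ (V 0 ω - m) u : ℝ) • (V 0 ω - m) ∂μ = S u) (h u : H) :
    TendstoInDistribution
      (fun (N : ℕ) ω => √(N : ℝ) * inner ℝ (avg N fun i => infl S m h (V i ω)) u) atTop id (fun _ => μ)
      (gaussianReal 0 (∫ ω, inner ℝ (infl S m h (V 0 ω)) u ^ 2 ∂μ).toNNReal) := by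
  have hg : Continuous fun x : H => (inner ℝ (infl S m h x) u : ℝ) :=
    (continuous_infl S m h).inner continuous_const
  have hF := memLp_infl hV S m h
  have hX : MemLp (fun ω => (inner ℝ (infl S m h (V 0 ω)) u : ℝ)) 2 μ := hF.inner_const u
  have h0 : ∫ ω, (inner ℝ (infl S m h (V 0 ω)) u : ℝ) ∂μ = 0 := by
    simp only [real_inner_comm u]
    rw [integral_inner (hF.integrable (by norm_num)), integral_infl hV hm hS, inner_zero_right]
  have hvar : Var[fun ω => (inner ℝ (infl S m h (V 0 ω)) u : ℝ); μ]
      = ∫ ω, inner ℝ (infl S m h (V 0 ω)) u ^ 2 ∂μ := by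
    rw [variance_eq_integral hX.1.aemeasurable, h0]
    simp
  have := tendstoInDistribution_inv_sqrt_mul_sum_sub (P := μ)
    (X := fun i ω => (inner ℝ (infl S m h (V i ω)) u : ℝ)) (Y := id)
    (P' := gaussianReal 0 (∫ ω, inner ℝ (infl S m h (V 0 ω)) u ^ 2 ∂μ).toNNReal)
    (by rw [hvar]; exact HasLaw.id) hX
    (hind.comp (fun _ x => (inner ℝ (infl S m h x) u : ℝ)) fun _ => hg.measurable)
    fun i => (hid i).comp hg.measurable
  convert this using 3 with N ω
  rw [h0, mul_zero, sub_zero, avg, inner_smul_left, sum_inner, ← mul_assoc]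
  congr 1
  rcases eq_or_ne N 0 with rfl | hN
  · simp
  · have : √(N : ℝ) ≠ 0 := by positivity
    have h2 : √(N : ℝ) ^ 2 = N := Real.sq_sqrt (by positivity)
    simp only [conj_trivial, map_inv₀]
    nth_rw 2 [← h2]
    field_simp

/-- Convergence on one fixed vector suffices for the remainder, so the strong law in `H` is enough
and no operator norm is involved. -/
lemma tendsto_sampleCov_apply (hid : ∀ i, IdentDistrib (V i) (V 0) μ μ)
    (hind : iIndepFun V μ) (hV : MemLp (V 0) 4 μ) (hm : ∫ ω, V 0 ω ∂μ = m)
    (hS : ∀ u, ∫ ω, (inner ℝ (V 0 ω - m) u : ℝ) • (V 0 ω - m) ∂μ = S u) (u : H) :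
    ∀ᵐ ω ∂μ, Tendsto (fun N => avg N fun i => V i ω) atTop (𝓝 m) ∧
      Tendsto (fun N => sampleCov N (fun i => V i ω) u) atTop (𝓝 (S u)) := by
  have a1 := tendsto_avg_comp hid hind continuous_id (hV.integrable (by norm_num))
  have a2 := tendsto_avg_comp hid hind
    (g := fun x => (inner ℝ (x - m) u : ℝ) • (x - m)) (by fun_prop)
    ((memLp_inner_smul_self ((hV.sub (memLp_const m))) u).integrable (by norm_num))
  simp only [id] at a1
  rw [hm] at a1
  rw [hS] at a2
  filter_upwards [a1, a2] with ω h1 h2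
  refine ⟨h1, ?_⟩
  have h3 : Tendsto (fun N => (avg N fun i => V i ω) - m) atTop (𝓝 0) := by
    simpa using h1.sub_const m
  have h4 := h2.sub ((h3.inner (𝕜 := ℝ) (tendsto_const_nhds (x := u))).smul h3)
  rw [smul_zero, sub_zero] at h4
  refine h4.congr' ?_
  filter_upwards [eventually_ne_atTop 0] with N hN
  exact (sampleCov_apply_eq hN _ m u).symm

/-- The remainder in the first order expansion of the empirical solution is negligible. -/
lemma tendstoInMeasure_remainder (hlam : 0 < lam) (hSp : IsCovOp S)
    (hid : ∀ i, IdentDistrib (V i) (V 0) μ μ)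
    (hind : iIndepFun V μ) (hV : MemLp (V 0) 4 μ) (hm : ∫ ω, V 0 ω ∂μ = m)
    (hS : ∀ u, ∫ ω, (inner ℝ (V 0 ω - m) u : ℝ) • (V 0 ω - m) ∂μ = S u) (φ : H) :
    TendstoInMeasure μ (fun (N : ℕ) ω => √(N : ℝ) *
      (inner ℝ (regSol (sampleCov N fun i => V i ω) lam (avg N fun i => V i ω) - regSol S lam m) φ
        - inner ℝ (avg N fun i => infl S m (regSol S lam m) (V i ω)) (regSol S lam φ)))
      atTop 0 := by
  have hVi : ∀ i, MemLp (V i) 4 μ := fun i => (hid i).memLp_iff.2 hV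
  set h := regSol S lam m with hh
  set u := regSol S lam φ with hu
  have hd2 : ∀ N, MemLp (fun ω => (avg N fun i => V i ω) - m) 2 μ := fun N =>
    ((memLp_avg hVi N).sub (memLp_const m)).mono_exponent (by norm_num)
  have hFi : ∀ i, MemLp (fun ω => infl S m h (V i ω)) 2 μ := fun i =>
    ((hid i).comp (continuous_infl S m h).measurable).memLp_iff.2 (memLp_infl hV S m h)
  have ha2 : ∀ N, MemLp (fun ω => avg N fun i => infl S m h (V i ω)) 2 μ := memLp_avg hFi
  have i1 : ∀ N : ℕ, Integrable (fun ω => N * ‖(avg N fun i => V i ω) - m‖ ^ 2) μ := fun N =>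
    ((hd2 N).integrable_norm_pow (by norm_num)).const_mul _
  have i2 : ∀ N : ℕ, Integrable (fun ω => N * ‖avg N fun i => infl S m h (V i ω)‖ ^ 2) μ :=
    fun N => ((ha2 N).integrable_norm_pow (by norm_num)).const_mul _
  have i12 : ∀ N : ℕ, Integrable (fun ω => 1 + N * ‖(avg N fun i => V i ω) - m‖ ^ 2) μ := fun N =>
    (integrable_const _).add (i1 N)
  refine tendstoInMeasure_of_le_mul
    (A := fun N ω => 1 + N * ‖(avg N fun i => V i ω) - m‖ ^ 2
        + N * ‖avg N fun i => infl S m h (V i ω)‖ ^ 2)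
    (B := fun N ω => ‖(avg N fun i => V i ω) - m‖ * (‖h‖ * ‖u‖)
        + lam⁻¹ * (1 + ‖(avg N fun i => V i ω) - m‖ * ‖h‖)
          * ‖sampleCov N (fun i => V i ω) u - S u‖)
    (C := 1 + ∫ ω, ‖V 0 ω - m‖ ^ 2 ∂μ + ∫ ω, ‖infl S m h (V 0 ω)‖ ^ 2 ∂μ)
    (fun N ω => by positivity) (fun N => (i12 N).add (i2 N)) ?_ (fun N ω => by positivity) ?_ ?_
  · filter_upwards [eventually_ne_atTop 0] with N hN
    -- After scaling by `N`, the second moments of centered averages do not depend on `N`, so the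
    -- bound `C` is attained.
    rw [integral_add (i12 N) (i2 N), integral_add (integrable_const _) (i1 N)]
    have e1 := integral_norm_avg_comp_sq hid hind (continuous_infl S m h) (memLp_infl hV S m h)
      (integral_infl hV hm hS h) hN
    have e2 := integral_norm_avg_comp_sq hid hind (g := fun x => x - m) (by fun_prop)
      (((hV.sub (memLp_const m))).mono_exponent (by norm_num)) (by
        rw [integral_sub (hV.integrable (by norm_num)) (integrable_const _), hm]; simp) hN
    simp only [avg_sub_const hN] at e2
    rw [e1, e2]
    simp
  · have hVm : ∀ i, AEStronglyMeasurable (V i) μ := fun i => (hVi i).1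
    refine tendstoInMeasure_of_tendsto_ae (fun N => ?_) ?_
    · have m1 := (hd2 N).1.norm
      have m2 := (((aestronglyMeasurable_sampleCov hVm N).apply_continuousLinearMap u).sub
        (aestronglyMeasurable_const (b := S u))).norm
      exact (m1.mul_const _).add (((aestronglyMeasurable_const.add (m1.mul_const _)).const_mul _).mul m2)
    · filter_upwards [tendsto_sampleCov_apply hid hind hV hm hS u] with ω hω
      have t1 : Tendsto (fun N => ‖(avg N fun i => V i ω) - m‖) atTop (𝓝 0) := by
        simpa using (hω.1.sub_const m).norm
      have t2 : Tendsto (fun N => ‖sampleCov N (fun i => V i ω) u - S u‖) atTop (𝓝 0) := by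
        simpa using (hω.2.sub_const (S u)).norm
      have := (t1.mul_const (‖h‖ * ‖u‖)).add
        ((((t1.mul_const ‖h‖).const_add 1).const_mul lam⁻¹).mul t2)
      simpa using this
  · filter_upwards [eventually_ne_atTop 0] with N hN ω
    rw [abs_mul, abs_of_nonneg (Real.sqrt_nonneg _)]
    exact norm_remainder_le hSp hlam m φ hN fun i => V i ω

theorem tendstoInDistribution_inner_regSol (hlam : 0 < lam) (hSp : IsCovOp S)
    (hid : ∀ i, IdentDistrib (V i) (V 0) μ μ)
    (hind : iIndepFun V μ) (hV : MemLp (V 0) 4 μ) (hm : ∫ ω, V 0 ω ∂μ = m)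
    (hS : ∀ u, ∫ ω, (inner ℝ (V 0 ω - m) u : ℝ) • (V 0 ω - m) ∂μ = S u) (φ : H) :
    TendstoInDistribution (fun (N : ℕ) ω => √(N : ℝ) *
      (inner ℝ (regSol (sampleCov N fun i => V i ω) lam (avg N fun i => V i ω)
        - regSol S lam m) φ : ℝ)) atTop id (fun _ => μ)
      (gaussianReal 0 (∫ ω,
        inner ℝ (infl S m (regSol S lam m) (V 0 ω)) (regSol S lam φ) ^ 2 ∂μ).toNNReal) := by
  have hVm : ∀ i, AEStronglyMeasurable (V i) μ := fun i => ((hid i).memLp_iff.2 hV).1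
  -- Slutsky: the difference from the linear part tends to zero in probability.
  refine tendstoInDistribution_of_tendstoInMeasure_sub _ _
    (tendstoInDistribution_inner_avg_infl hid hind hV hm hS (regSol S lam m) (regSol S lam φ))
    ?_ fun N => ?_
  · convert tendstoInMeasure_remainder hlam hSp hid hind hV hm hS φ using 3 with N ω
    simp only [Pi.sub_apply]
    ring
  · exact ((((aestronglyMeasurable_regSol hVm hlam N).sub
      (aestronglyMeasurable_const (b := regSol S lam m))).inner
      (aestronglyMeasurable_const (b := φ))).const_mul _).aemeasurable

end Asymptotics

/-! ### The population and the empirical problem -/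

section SecondMoment

variable {T : Type*} [MeasurableSpace T] {P : Measure T} {H : Type*} [NormedAddCommGroup H]
  [InnerProductSpace ℝ H] {W : T → H}

lemma memLp_four_of_integrable {T E : Type*} [MeasurableSpace T] {P : Measure T}
    [NormedAddCommGroup E] {W : T → E} (hm : AEStronglyMeasurable W P)
    (h : Integrable (fun z => ‖W z‖ ^ 4) P) : MemLp W 4 P := by
  refine (integrable_norm_rpow_iff hm (by norm_num) (by norm_num)).1 ?_
  refine h.congr (ae_of_all _ fun z => ?_)
  change ‖W z‖ ^ 4 = ‖W z‖ ^ (4 : ENNReal).toReal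
  rw [show (4 : ENNReal).toReal = ((4 : ℕ) : ℝ) by norm_num, Real.rpow_natCast]

lemma integrable_rankOne (hW : MemLp W 2 P) :
    Integrable (fun z => (rankOne ℝ (W z) (W z) : H →L[ℝ] H)) P := by
  have hc : Continuous fun x : H => (rankOne ℝ x x : H →L[ℝ] H) := by
    simp only [rankOne_def]
    exact (ContinuousLinearMap.smulRightL ℝ H H).continuous₂.comp
      ((innerSL ℝ).continuous.prodMk continuous_id)
  refine (hW.integrable_norm_pow (p := 2) (by norm_num)).mono' (hc.comp_aestronglyMeasurable hW.1)
    (ae_of_all _ fun z => ?_)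
  rw [norm_rankOne, sq]

lemma integral_rankOne_apply (hW : MemLp W 2 P) (u : H) :
    (∫ z, (rankOne ℝ (W z) (W z) : H →L[ℝ] H) ∂P) u = ∫ z, (inner ℝ (W z) u : ℝ) • W z ∂P := by
  rw [ContinuousLinearMap.integral_apply (integrable_rankOne hW)]
  rfl

variable [CompleteSpace H]

lemma inner_integral_rankOne (hW : MemLp W 2 P) (u v : H) :
    (inner ℝ v ((∫ z, (rankOne ℝ (W z) (W z) : H →L[ℝ] H) ∂P) u) : ℝ)
      = ∫ z, inner ℝ v (W z) * inner ℝ u (W z) ∂P := by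
  have hi : Integrable (fun z => (inner ℝ (W z) u : ℝ) • W z) P :=
    (integrable_rankOne hW).apply_continuousLinearMap u
  rw [integral_rankOne_apply hW, ← integral_inner hi]
  refine integral_congr_ae (ae_of_all _ fun z => ?_)
  simp only [inner_smul_right, real_inner_comm u]
  ring

lemma isCovOp_integral_rankOne (hW : MemLp W 2 P) :
    IsCovOp (∫ z, (rankOne ℝ (W z) (W z) : H →L[ℝ] H) ∂P) where
  symm u v := by
    rw [real_inner_comm, inner_integral_rankOne hW, inner_integral_rankOne hW]
    simp only [mul_comm]
  nonneg u := by
    rw [inner_integral_rankOne hW]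
    exact integral_nonneg fun z => mul_self_nonneg _

end SecondMoment

/-! ### Reduction of the mean-variance problems to regularized quadratic ones, and the limit on the
grid. -/

section Problem

variable {d s : ℕ} {X : Set (EuclideanSpace ℝ (Fin d))} {Y : Set ℝ} {H : Type*}
  [NormedAddCommGroup H] [InnerProductSpace ℝ H] [CompleteSpace H] [RKHS ℝ H X ℝ]
  {w : (Fin d → ℕ) → X × Y → ℝ} {P : Measure (X × Y)} {lam : ℝ} {n : ℕ} {α : Fin d → ℕ} {ξ : Fin n → X}

lemma empObjective_eq (hX : X ⊆ closure (interior X)) (hK : IsCk (2 * s) (kernProd (X := X) H))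
    (N : ℕ) (z : ℕ → X × Y) (h : H) :
    empObjective s w N z lam h = quadObj (sampleCov N fun i => psi H s w (z i)) lam
      (avg N fun i => psi H s w (z i)) h := by
  simp only [empObjective, quadObj, target_eq_inner hX hK, inner_avg, sampleVar_inner]

lemma hEmp_eq (hX : X ⊆ closure (interior X)) (hK : IsCk (2 * s) (kernProd (X := X) H))
    (hlam : 0 < lam) (N : ℕ) (z : ℕ → X × Y) :
    hEmp H s w N z lam = regSol (sampleCov N fun i => psi H s w (z i)) lam
      (avg N fun i => psi H s w (z i)) :=
  (isCovOp_sampleCov N _).argmin_eq hlam (empObjective_eq hX hK N z)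

lemma dotProduct_omegaMat (t : Fin n → ℝ) :
    t ⬝ᵥ (omegaMat H s w P lam α ξ).mulVec t
      = inner ℝ (∑ k, t k • uVec H s w P lam α ξ k)
        (Q H s w P lam (∑ j, t j • uVec H s w P lam α ξ j)) := by
  simp only [dotProduct, Matrix.mulVec, omegaMat, Matrix.of_apply, map_sum, map_smul, sum_inner,
    inner_sum, inner_smul_left, inner_smul_right, conj_trivial, Finset.mul_sum]
  rw [Finset.sum_comm]
  refine Finset.sum_congr rfl fun k _ => Finset.sum_congr rfl fun j _ => ?_
  ring

lemma sum_smul_uVec (t : Fin n → ℝ) : ∑ j, t j • uVec H s w P lam α ξ j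
    = regSol (covPsi H s w P) lam (∑ j, t j • featDeriv H α (ξ j)) := by
  simp only [regSol, map_sum, map_smul]
  rfl

lemma inner_gridEval_sub (hX : X ⊆ closure (interior X))
    (hK : IsCk (2 * s) (kernProd (X := X) H)) (hα : α ∈ multiIdx d s) (a b : H)
    (t : EuclideanSpace ℝ (Fin n)) :
    (inner ℝ (gridEval α ξ a - gridEval α ξ b) t : ℝ)
      = inner ℝ (a - b) (∑ j, t j • featDeriv H α (ξ j)) := by
  rw [PiLp.inner_apply, inner_sum]
  refine Finset.sum_congr rfl fun j _ => ?_
  simp [gridEval, D_eq_inner_featDeriv hX hK hα, inner_smul_right, inner_sub_left]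

variable [IsProbabilityMeasure P]

lemma memLp_psi_sub_mean (hψ : MemLp (psi H s w) 4 P) :
    MemLp (fun z => psi H s w z - meanPsi H s w P) 4 P :=
  hψ.sub (memLp_const _)

lemma isCovOp_covPsi (hψ : MemLp (psi H s w) 4 P) : IsCovOp (covPsi H s w P) :=
  isCovOp_integral_rankOne ((memLp_psi_sub_mean hψ).mono_exponent (by norm_num))

lemma popObjective_eq (hX : X ⊆ closure (interior X)) (hK : IsCk (2 * s) (kernProd (X := X) H))
    (hψ : MemLp (psi H s w) 4 P) (h : H) :
    popObjective s w P lam h = quadObj (covPsi H s w P) lam (meanPsi H s w P) h := by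
  have ht : target s w h = fun z => inner ℝ h (psi H s w z) := funext (target_eq_inner hX hK h)
  have hi : Integrable (psi H s w) P := hψ.integrable (by norm_num)
  have hmean : ∫ z, (inner ℝ h (psi H s w z) : ℝ) ∂P = inner ℝ h (meanPsi H s w P) :=
    integral_inner hi h
  rw [popObjective, quadObj, ht, hmean, variance_eq_integral, hmean, covPsi,
    inner_integral_rankOne ((memLp_psi_sub_mean hψ).mono_exponent (by norm_num))]
  · simp only [inner_sub_right, sq]
  · exact ((hψ.1.const_inner (𝕜 := ℝ) (c := h))).aemeasurable

lemma hPop_eq (hX : X ⊆ closure (interior X)) (hK : IsCk (2 * s) (kernProd (X := X) H))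
    (hψ : MemLp (psi H s w) 4 P) (hlam : 0 < lam) :
    hPop H s w P lam = regSol (covPsi H s w P) lam (meanPsi H s w P) :=
  (isCovOp_covPsi hψ).argmin_eq hlam (popObjective_eq hX hK hψ)

lemma memLp_influence (hψ : MemLp (psi H s w) 4 P) (lam : ℝ) :
    MemLp (influence H s w P lam) 2 P :=
  -- `influence` unfolds to `infl` at `psi`, the rank-one operator applied to `h_λ` being an inner
  -- product times a vector.
  memLp_infl hψ _ _ _

theorem posSemidef_omegaMat (hψ : MemLp (psi H s w) 4 P) :
    (omegaMat H s w P lam α ξ).PosSemidef := by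
  have hQ : IsCovOp (Q H s w P lam) := isCovOp_integral_rankOne (memLp_influence hψ lam)
  refine Matrix.PosSemidef.of_dotProduct_mulVec_nonneg ?_ fun t => ?_
  · ext k j
    simp only [Matrix.conjTranspose_apply, omegaMat, Matrix.of_apply, star_trivial]
    rw [← hQ.symm, real_inner_comm]
  · rw [star_trivial, dotProduct_omegaMat]
    exact hQ.nonneg _

theorem tendstoInDistribution_gridEval [MeasurableSpace H] [BorelSpace H]
    (hX : X ⊆ closure (interior X)) (hK : IsCk (2 * s) (kernProd (X := X) H))
    (hψm : StronglyMeasurable (psi H s w : X × Y → H)) (hψ : MemLp (psi H s w) 4 P)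
    (hlam : 0 < lam) {S : Type*} [MeasurableSpace S] (μ : Measure S) [IsProbabilityMeasure μ]
    (Z : ℕ → S → X × Y) (hZ : ∀ i, HasLaw (Z i) P μ)
    (hindep : iIndepFun (fun i ω => psi H s w (Z i ω)) μ) (hα : α ∈ multiIdx d s) :
    TendstoInDistribution
      (fun (N : ℕ) (ω : S) => √(N : ℝ) •
        (gridEval α ξ (hEmp H s w N (fun i => Z i ω) lam) - gridEval α ξ (hPop H s w P lam)))
      atTop (id : EuclideanSpace ℝ (Fin n) → EuclideanSpace ℝ (Fin n)) (fun _ => μ)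
      (multivariateGaussian 0 (omegaMat H s w P lam α ξ)) := by
  have hid : ∀ i, IdentDistrib (fun ω => psi H s w (Z i ω)) (fun ω => psi H s w (Z 0 ω)) μ μ :=
    fun i => ((hZ i).identDistrib (hZ 0)).comp hψm.measurable
  have hV : MemLp (fun ω => psi H s w (Z 0 ω)) 4 μ := by
    rw [← (hZ 0).map_eq] at hψ
    exact (memLp_map_measure_iff hψm.aestronglyMeasurable (hZ 0).aemeasurable).1 hψ
  have hm : ∫ ω, psi H s w (Z 0 ω) ∂μ = meanPsi H s w P :=
    (hZ 0).integral_comp hψm.aestronglyMeasurable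
  have hS : ∀ u, ∫ ω, (inner ℝ (psi H s w (Z 0 ω) - meanPsi H s w P) u : ℝ) •
      (psi H s w (Z 0 ω) - meanPsi H s w P) ∂μ = covPsi H s w P u := by
    intro u
    rw [covPsi, integral_rankOne_apply ((memLp_psi_sub_mean hψ).mono_exponent (by norm_num))]
    exact (hZ 0).integral_comp
      (memLp_inner_smul_self (memLp_psi_sub_mean hψ) u).1
  have hsol := hPop_eq hX hK hψ hlam
  have hVm : ∀ i, AEStronglyMeasurable (fun ω => psi H s w (Z i ω)) μ :=
    fun i => ((hid i).memLp_iff.2 hV).1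
  refine tendstoInDistribution_multivariateGaussian (fun N => ?_) (posSemidef_omegaMat hψ)
    fun t => ⟨(∫ ω, inner ℝ (infl (covPsi H s w P) (meanPsi H s w P)
      (regSol (covPsi H s w P) lam (meanPsi H s w P)) (psi H s w (Z 0 ω)))
      (regSol (covPsi H s w P) lam (∑ j, t j • featDeriv H α (ξ j))) ^ 2 ∂μ).toNNReal, ?_, ?_⟩
  · suffices h : AEMeasurable (fun ω => gridEval α ξ (hEmp H s w N (fun i => Z i ω) lam)) μ from
      (h.sub_const (gridEval α ξ (hPop H s w P lam))).const_smul √(N : ℝ)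
    refine (WithLp.measurable_toLp 2 _).comp_aemeasurable (aemeasurable_pi_lambda _ fun j => ?_)
    simp only [D_eq_inner_featDeriv hX hK hα, hEmp_eq hX hK hlam]
    exact ((aestronglyMeasurable_regSol hVm hlam N).inner aestronglyMeasurable_const).aemeasurable
  rotate_left
  · have := tendstoInDistribution_inner_regSol hlam (isCovOp_covPsi hψ) hid hindep hV hm hS
      (∑ j, t j • featDeriv H α (ξ j))
    refine this.congr (fun N => ae_of_all _ fun ω => ?_) EventuallyEq.rfl
    simp only
    rw [inner_smul_left, inner_gridEval_sub hX hK hα, hEmp_eq hX hK hlam, hsol]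
    rfl
  -- Variance matching: with `u = Σ_λ⁻¹ ∑ t_j φ^(α)(ξ_j)`, the quadratic form of `Ω_λ` at `t` is
  -- `⟪u, Q_λ u⟫ = E⟪F, u⟫²`, and the law of `Z 0` carries it to the sample space.
  · rw [dotProduct_omegaMat, sum_smul_uVec, Q, inner_integral_rankOne (memLp_influence hψ lam),
      Real.coe_toNNReal _ (integral_nonneg fun ω => sq_nonneg _), ← hsol]
    have hF := (memLp_influence hψ lam (H := H)).1
    refine Eq.trans ((hZ 0).integral_comp (f := fun z => inner ℝ (influence H s w P lam z)
      (regSol (covPsi H s w P) lam (∑ j, t j • featDeriv H α (ξ j))) ^ 2)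
      ((hF.inner aestronglyMeasurable_const).pow 2)) ?_
    refine integral_congr_ae (ae_of_all _ fun z => ?_)
    simp only
    rw [real_inner_comm, sq]

end Problem

end MeanVar

theorem mainTheorem4
    -- the domain, the reproducing kernel Hilbert space and the smoothness of its kernel
    {d s : ℕ} {X : Set (EuclideanSpace ℝ (Fin d))} {Y : Set ℝ}
    (hX : X ⊆ closure (interior X))
    {H : Type*} [NormedAddCommGroup H] [InnerProductSpace ℝ H] [CompleteSpace H] [RKHS ℝ H X ℝ]
    [MeasurableSpace H] [BorelSpace H]
    (hK : MeanVar.IsCk (2 * s) (MeanVar.kernProd (X := X) H))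
    -- the weights and the population distribution, with the fourth moment assumption
    (w : (Fin d → ℕ) → X × Y → ℝ) (hw : ∀ β ∈ MeanVar.multiIdx d s, Measurable (w β))
    (P : Measure (X × Y)) [IsProbabilityMeasure P]
    (hP : Integrable (fun z => ‖MeanVar.psi H s w z‖ ^ 4) P)
    {lam : ℝ} (hlam : 0 < lam)
    -- the observations
    {S : Type*} [MeasurableSpace S] (μ : Measure S) [IsProbabilityMeasure μ]
    (Z : ℕ → S → X × Y) (hZ : ∀ i, HasLaw (Z i) P μ)
    (hindep : iIndepFun (fun i ω => MeanVar.psi H s w (Z i ω)) μ)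
    -- the derivative order and the grid
    (α : Fin d → ℕ) (hα : α ∈ MeanVar.multiIdx d s) {n : ℕ} (ξ : Fin n → X) :
    -- the objects are well defined
    (∀ h : H, MeanVar.IsCk s (fun x : X => h x)) ∧
    (∀ β ∈ MeanVar.multiIdx d s, ∀ x : X,
      (∀ y : X, MeanVar.featDeriv H β x y = MeanVar.D β (fun x' : X => MeanVar.kern H x' y) x) ∧
      ∀ h : H, MeanVar.D β (fun x' : X => h x') x = inner ℝ h (MeanVar.featDeriv H β x)) ∧
    (∃! h : H, ∀ g : H, MeanVar.popObjective s w P lam h ≤ MeanVar.popObjective s w P lam g) ∧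
    (∀ (N : ℕ) (ω : S), ∃! h : H, ∀ g : H,
      MeanVar.empObjective s w N (fun i => Z i ω) lam h
        ≤ MeanVar.empObjective s w N (fun i => Z i ω) lam g) ∧
    (MeanVar.omegaMat H s w P lam α ξ).PosSemidef ∧
    -- the asymptotic distribution
    TendstoInDistribution
      (fun (N : ℕ) (ω : S) => √(N : ℝ) •
        (MeanVar.gridEval α ξ (MeanVar.hEmp H s w N (fun i => Z i ω) lam)
          - MeanVar.gridEval α ξ (MeanVar.hPop H s w P lam)))
      atTop
      (id : EuclideanSpace ℝ (Fin n) → EuclideanSpace ℝ (Fin n))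
      (fun _ => μ)
      (multivariateGaussian 0 (MeanVar.omegaMat H s w P lam α ξ)) := by
  have hψm := MeanVar.stronglyMeasurable_psi (H := H) (Y := Y) hX hK hw
  have hψ := MeanVar.memLp_four_of_integrable hψm.aestronglyMeasurable hP
  exact ⟨MeanVar.isCk_coe hX hK,
    fun β hβ x => ⟨MeanVar.featDeriv_apply hX hK hβ x,
      fun h => MeanVar.D_eq_inner_featDeriv hX hK hβ h x⟩,
    (MeanVar.isCovOp_covPsi hψ).existsUnique_min hlam (MeanVar.popObjective_eq hX hK hψ),
    -- This includes `N = 0`: empty averages are zero, and the objective reduces to the penalty.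
    fun N ω => (MeanVar.isCovOp_sampleCov N _).existsUnique_min hlam
      (MeanVar.empObjective_eq hX hK N fun i => Z i ω),
    MeanVar.posSemidef_omegaMat hψ,
    MeanVar.tendstoInDistribution_gridEval hX hK hψm hψ hlam μ Z hZ hindep hα⟩
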